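/- Let $\Omega\subset\mathbb R^2$ be a bounded Lipschitz domain with boundary $\Gamma=\partial\Omega$ and unit outward normal $n$ (which exists almost everywhere on $\Gamma$), and let $\Gamma_D,\Gamma_S,\Gamma_T\subset\Gamma$ be pairwise disjoint Borel sets that cover $\Gamma$ up to a set of length zero. Let $T,\rho,\mu,g,c_0>0$, let $\zeta\in C^1(\overline\Omega)$ with $\zeta>0$ on $\overline\Omega$, and put $c(x)=c_0\sqrt{g\zeta(x)}$. Let $\phi\in C^1(\overline\Omega\times[0,T];\mathbb R)$ and $u\in C^2(\overline\Omega\times[0,T];\mathbb R^2)$ (for instance, let $\phi$ and $u$ be $C^\infty$), put $\eta=\phi-\zeta$ and $D(u)=\frac12(\nabla u+(\nabla u)^T)$, and suppose that in $\Omega\times(0,T)$ $$\frac{\partial\phi}{\partial t}+\nabla\cdot(\phi u)=0,\qquad \rho\phi\Bigl[\frac{\partial u}{\partial t}+(u\cdot\nabla)u\Bigr]-2\mu\nabla\cdot(\phi D(u))+\rho g\phi\nabla\eta=0,$$ and that the following boundary conditions hold, those that involve $n$ at the points where $n$ exists: $u=0$ on $\Gamma_D\times(0,T)$ (Dirichlet);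 $(D(u)n)\times n=0$ and $u\cdot n=0$ on $\Gamma_S\times(0,T)$ (slip); $\phi\neq0$ and $u=c\,\frac{\eta}{\phi}\,n$ on $\Gamma_T\times(0,T)$ (transmission). For $t\in[0,T]$ define $$E(t)=\int_\Omega\frac{\rho}{2}\phi|u|^2\,dx+\int_\Omega\frac{\rho g|\eta|^2}{2}\,dx,\qquad I_4(t;\Omega)=-2\mu\int_\Omega\phi|D(u)|^2\,dx,$$ $$I_1(t;\Gamma_T)=-\frac{\rho}{2}\int_{\Gamma_T}\phi|u|^2\,u\cdot n\,ds,\quad I_2(t;\Gamma_T)=-\rho g\int_{\Gamma_T}\phi\,\eta\,u\cdot n\,ds,\quad I_3(t;\Gamma_T)=2\mu\int_{\Gamma_T}\phi\,[D(u)n]\cdot u\,ds,$$ where $|D(u)|$ is the Frobenius norm and $ds$ is arc length. (i) For every $t\in[0,T]$, the energy $E$ is differentiable at $t$ (one-sidedly if $t=0$ or $t=T$) and $$\frac{d}{dt}E(t)=\sum_{i=1}^3I_i(t;\Gamma_T)+I_4(t;\Omega).$$ (ii) If, furthermore, there is no transmission boundary ($\Gamma_T=\varnothing$, in particular if $\Gamma=\Gamma_D\cup\Gamma_S$)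 and $\phi(x,t)>0$ for all $(x,t)\in\overline\Omega\times[0,T]$, then for every $t\in[0,T]$ $$\frac{d}{dt}E(t)=I_4(t;\Omega)\le0,$$ so $E$ is non-increasing on $[0,T]$. -/

import Mathlib

open Set Filter Topology MeasureTheory
open scoped NNReal Matrix

namespace ShallowWater

/-- The Euclidean plane `ℝ²`. -/
abbrev Plane : Type := EuclideanSpace ℝ (Fin 2)

/-! ### Domains, normals, arc length -/

/-- A bounded Lipschitz domain of the plane: a bounded, nonempty, connected open set which, near
each of its boundary points and in suitable Cartesian coordinates, is the set of points lying
strictly below the graph of a Lipschitz function. -/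
structure IsBoundedLipschitzDomain (Ω : Set Plane) : Prop where
  isOpen : IsOpen Ω
  isConnected : IsConnected Ω
  isBounded : Bornology.IsBounded Ω
  lipschitz_boundary : ∀ x₀ ∈ frontier Ω,
    ∃ (A : Plane ≃ᵃⁱ[ℝ] Plane) (f : ℝ → ℝ) (K : ℝ≥0), LipschitzWith K f ∧
      ∀ᶠ x in 𝓝 x₀, (x ∈ Ω ↔ A x 1 < f (A x 0))

/-- `ν` is the unit outward normal vector of `Ω` at the boundary point `x`: near `x`, the set `Ω`
is asymptotically the half-plane `⟪y - x, ν⟫ < 0`. (On the boundary of a Lipschitz domain such a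
vector exists at almost every point; it does not exist at corners.) -/
def IsUnitOutwardNormal (Ω : Set Plane) (x ν : Plane) : Prop :=
  ‖ν‖ = 1 ∧ ∀ ε > 0, ∀ᶠ y in 𝓝 x,
    (inner ℝ (y - x) ν < -(ε * ‖y - x‖) → y ∈ Ω) ∧ (ε * ‖y - x‖ < inner ℝ (y - x) ν → y ∉ Ω)

open Classical in
/-- The unit outward normal field of `Ω`, with value `0` where there is no normal. -/
noncomputable def outwardNormal (Ω : Set Plane) (x : Plane) : Plane :=
  if h : ∃ ν, IsUnitOutwardNormal Ω x ν then h.choose else 0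

/-- The arc length measure `ds` on a subset `G` of the boundary: one-dimensional Hausdorff
measure. -/
noncomputable def arcLength (G : Set Plane) : Measure Plane :=
  (Measure.hausdorffMeasure (1 : ℝ)).restrict G

/-- The boundary of `Ω` consists of the three non-overlapping (Borel) parts `ΓD`, `ΓS`, `ΓT`, up to
a set of length zero (such as the end points of arcs). -/
structure IsBoundaryPartition (Ω ΓD ΓS ΓT : Set Plane) : Prop where
  subset_D : ΓD ⊆ frontier Ω
  subset_S : ΓS ⊆ frontier Ω
  subset_T : ΓT ⊆ frontier Ω
  measurable_D : MeasurableSet ΓD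
  measurable_S : MeasurableSet ΓS
  measurable_T : MeasurableSet ΓT
  disjoint_DS : Disjoint ΓD ΓS
  disjoint_ST : Disjoint ΓS ΓT
  disjoint_TD : Disjoint ΓT ΓD
  cover : Measure.hausdorffMeasure (1 : ℝ) (frontier Ω \ (ΓD ∪ ΓS ∪ ΓT)) = 0

/-! ### Differential operators

Spatial derivatives are taken within the closure of the domain `Ω`: at points of the open set `Ω`
they are the usual ones, at boundary points they are the values up to the boundary. -/

/-- The partial derivative `∂f/∂x_i` on the closure of `Ω`. -/
noncomputable def partialDeriv (Ω : Set Plane) (i : Fin 2) (f : Plane → ℝ) (x : Plane) : ℝ :=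
  fderivWithin ℝ f (closure Ω) x (EuclideanSpace.single i 1)

/-- The divergence of a vector field. -/
noncomputable def divergence (Ω : Set Plane) (v : Plane → Plane) (x : Plane) : ℝ :=
  ∑ j, partialDeriv Ω j (fun y => v y j) x

/-- The strain-rate tensor `D(v) = (∇v + (∇v)ᵀ) / 2`. -/
noncomputable def strainRate (Ω : Set Plane) (v : Plane → Plane) (x : Plane) :
    Matrix (Fin 2) (Fin 2) ℝ :=
  Matrix.of fun i j =>
    (partialDeriv Ω j (fun y => v y i) x + partialDeriv Ω i (fun y => v y j) x) / 2

/-- The squared Frobenius norm `|A|² = A : A` of a matrix. -/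
def frobeniusSq (A : Matrix (Fin 2) (Fin 2) ℝ) : ℝ := ∑ i, ∑ j, A i j ^ 2

/-- The vector `A w`. -/
noncomputable def applyMatrix (A : Matrix (Fin 2) (Fin 2) ℝ) (w : Plane) : Plane :=
  WithLp.toLp 2 (A *ᵥ w.ofLp)

/-- The (scalar) cross product of two plane vectors. -/
def cross (a b : Plane) : ℝ := a 0 * b 1 - a 1 * b 0

/-! ### The shallow water equations -/

/-- The water level `η = φ - ζ`. -/
def elevation (ζ : Plane → ℝ) (φ : Plane → ℝ → ℝ) (x : Plane) (t : ℝ) : ℝ := φ x t - ζ x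

/-- The pair `(φ, u)` satisfies the shallow water equations in `Ω × (0, T)`:
`∂φ/∂t + ∇·(φ u) = 0`, `ρ φ [∂u/∂t + (u·∇)u] - 2 μ ∇·(φ D(u)) + ρ g φ ∇η = 0`, `φ = η + ζ`. -/
structure SatisfiesSWE (Ω : Set Plane) (T ρ μ g : ℝ) (ζ : Plane → ℝ)
    (φ : Plane → ℝ → ℝ) (u : Plane → ℝ → Plane) : Prop where
  mass : ∀ x ∈ Ω, ∀ t ∈ Ioo 0 T,
    deriv (fun s => φ x s) t + divergence Ω (fun y => φ y t • u y t) x = 0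
  momentum : ∀ x ∈ Ω, ∀ t ∈ Ioo 0 T, ∀ i : Fin 2,
    ρ * φ x t *
        (deriv (fun s => u x s i) t + ∑ j, u x t j * partialDeriv Ω j (fun y => u y t i) x)
      - 2 * μ *
        ∑ j, partialDeriv Ω j (fun y => φ y t * strainRate Ω (fun z => u z t) y i j) x
      + ρ * g * φ x t * partialDeriv Ω i (fun y => elevation ζ φ y t) x = 0

/-- The Dirichlet condition `u = 0` on `ΓD × (0, T)`. -/
def DirichletCondition (T : ℝ) (ΓD : Set Plane) (u : Plane → ℝ → Plane) : Prop :=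
  ∀ x ∈ ΓD, ∀ t ∈ Ioo 0 T, u x t = 0

/-- The slip condition `(D(u) n) × n = 0`, `u · n = 0` on `ΓS × (0, T)` (at the points where the
normal `n` exists). -/
def SlipCondition (Ω : Set Plane) (T : ℝ) (ΓS : Set Plane) (u : Plane → ℝ → Plane) : Prop :=
  ∀ x ∈ ΓS, ∀ n, IsUnitOutwardNormal Ω x n → ∀ t ∈ Ioo 0 T,
    cross (applyMatrix (strainRate Ω (fun y => u y t) x) n) n = 0 ∧ inner ℝ (u x t) n = 0

/-- The transmission condition `u = c (η / φ) n` on `ΓT × (0, T)` (at the points where the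
normal `n` exists), with `c = c₀ √(g ζ)`; it includes that the quotient makes sense. -/
def TransmissionCondition (Ω : Set Plane) (T g c₀ : ℝ) (ζ : Plane → ℝ) (ΓT : Set Plane)
    (φ : Plane → ℝ → ℝ) (u : Plane → ℝ → Plane) : Prop :=
  ∀ x ∈ ΓT, ∀ n, IsUnitOutwardNormal Ω x n → ∀ t ∈ Ioo 0 T,
    φ x t ≠ 0 ∧ u x t = (c₀ * √(g * ζ x) * (elevation ζ φ x t / φ x t)) • n

/-! ### Energy and the terms of its balance -/

/-- The kinetic energy. -/
noncomputable def kineticEnergy (Ω : Set Plane) (ρ : ℝ) (φ : Plane → ℝ → ℝ)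
    (u : Plane → ℝ → Plane) (t : ℝ) : ℝ :=
  ∫ x in Ω, ρ / 2 * φ x t * ‖u x t‖ ^ 2

/-- The potential energy. -/
noncomputable def potentialEnergy (Ω : Set Plane) (ρ g : ℝ) (ζ : Plane → ℝ) (φ : Plane → ℝ → ℝ)
    (t : ℝ) : ℝ :=
  ∫ x in Ω, ρ * g * |elevation ζ φ x t| ^ 2 / 2

/-- The total energy `E = E₁ + E₂`. -/
noncomputable def energy (Ω : Set Plane) (ρ g : ℝ) (ζ : Plane → ℝ) (φ : Plane → ℝ → ℝ)
    (u : Plane → ℝ → Plane) (t : ℝ) : ℝ :=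
  kineticEnergy Ω ρ φ u t + potentialEnergy Ω ρ g ζ φ t

/-- `I₁(t; G) = -(ρ/2) ∫_G φ |u|² u·n ds`. -/
noncomputable def I₁ (Ω : Set Plane) (ρ : ℝ) (φ : Plane → ℝ → ℝ) (u : Plane → ℝ → Plane)
    (G : Set Plane) (t : ℝ) : ℝ :=
  -(ρ / 2) * ∫ x, φ x t * ‖u x t‖ ^ 2 * inner ℝ (u x t) (outwardNormal Ω x) ∂(arcLength G)

/-- `I₂(t; G) = -ρ g ∫_G φ η u·n ds`. -/
noncomputable def I₂ (Ω : Set Plane) (ρ g : ℝ) (ζ : Plane → ℝ) (φ : Plane → ℝ → ℝ)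
    (u : Plane → ℝ → Plane) (G : Set Plane) (t : ℝ) : ℝ :=
  -(ρ * g) *
    ∫ x, φ x t * elevation ζ φ x t * inner ℝ (u x t) (outwardNormal Ω x) ∂(arcLength G)

/-- `I₃(t; G) = 2 μ ∫_G φ [D(u) n]·u ds`. -/
noncomputable def I₃ (Ω : Set Plane) (μ : ℝ) (φ : Plane → ℝ → ℝ) (u : Plane → ℝ → Plane)
    (G : Set Plane) (t : ℝ) : ℝ :=
  2 * μ * ∫ x, φ x t *
    inner ℝ (applyMatrix (strainRate Ω (fun y => u y t) x) (outwardNormal Ω x)) (u x t)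
      ∂(arcLength G)

/-- `I₄(t; Ω) = -2 μ ∫_Ω φ |D(u)|² dx`. -/
noncomputable def I₄ (Ω : Set Plane) (μ : ℝ) (φ : Plane → ℝ → ℝ) (u : Plane → ℝ → Plane)
    (t : ℝ) : ℝ :=
  -(2 * μ) * ∫ x in Ω, φ x t * frobeniusSq (strainRate Ω (fun y => u y t) x)

end ShallowWater

/-! Multiply the mass equation by `ρ/2 |u|² + ρ g η` and take the scalar product of the momentum
equation with `u`. Since `ζ` does not depend on time, `∂η/∂t = ∂φ/∂t`, and the sum is a local
balance (`energy_balance_pointwise`): the time derivative of the energy density equals `∇·F - 2 μ φ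
|D(u)|²`, where `F = 2 μ φ D(u) u - (ρ/2) φ |u|² u - ρ g φ η u`. The symmetry of `D(u)` turns `D(u)
: ∇u` into `|D(u)|²`. Differentiation under the integral sign and the divergence theorem give `dE/dt
= ∫_Γ F·n ds + I₄` for `0 < t < T`.

On the boundary, `F·n` is the sum of the integrands of `I₁`, `I₂`, `I₃`. It vanishes where `u = 0`.
On the slip part `u·n = 0` removes the first two terms; the third vanishes because `D(u) n` is
parallel to `n` and `u` is tangential. Only `ΓT` contributes. Both sides of the balance being
continuous on `[0, T]`, it extends to the end points as a one-sided derivative. Without `ΓT` only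
`I₄` remains, and `φ > 0` makes it nonpositive.

The analytic core is the divergence theorem on a Lipschitz domain, with arc length as Hausdorff
measure and a normal defined by the shape of `Ω` alone. It rests on two facts about a Lipschitz
graph: arc length has density `√(1 + f'²)` (`comap_graphMap_hausdorffMeasure`), and integration by
parts below the graph follows from Fubini and the one-dimensional fundamental theorem
(`integral_subgraph_fderiv`). By Rademacher's theorem the geometric normal is almost everywhere the
normal of the graph, and the length element cancels its normalization. A partition of unity
globalizes the result. -/

namespace ShallowWater

/-! ### Arc length on Lipschitz graphs -/

/-- The parametrization of the graph of `f` by the first coordinate. -/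
noncomputable def graphMap (f : ℝ → ℝ) (x : ℝ) : Plane := !₂[x, f x]

@[simp] lemma graphMap_zero (f : ℝ → ℝ) (x : ℝ) : graphMap f x 0 = x := rfl

@[simp] lemma graphMap_one (f : ℝ → ℝ) (x : ℝ) : graphMap f x 1 = f x := rfl

/-- The length element `√(1 + f'²)` of the graph of `f`. -/
noncomputable def graphSpeed (f : ℝ → ℝ) (x : ℝ) : ℝ := √(1 + deriv f x ^ 2)

lemma plane_dist_eq (p q : Plane) : dist p q = √((p 0 - q 0) ^ 2 + (p 1 - q 1) ^ 2) := by
  simp [EuclideanSpace.dist_eq, Fin.sum_univ_two, Real.dist_eq, sq_abs]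

lemma graphSpeed_pos (f : ℝ → ℝ) (x : ℝ) : 0 < graphSpeed f x := by
  unfold graphSpeed; positivity

lemma measurable_graphSpeed (f : ℝ → ℝ) : Measurable (graphSpeed f) :=
  ((measurable_deriv f).pow_const 2 |>.const_add 1).sqrt

lemma injective_graphMap (f : ℝ → ℝ) : Function.Injective (graphMap f) := fun x y h => by
  simpa using congrArg (fun p : Plane => p 0) h

variable {f : ℝ → ℝ} {K : ℝ≥0}

lemma continuous_graphMap (hf : Continuous f) : Continuous (graphMap f) := by
  unfold graphMap
  fun_prop

lemma measurableEmbedding_graphMap (hf : Continuous f) : MeasurableEmbedding (graphMap f) :=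
  (continuous_graphMap hf).measurableEmbedding (injective_graphMap f)

lemma abs_deriv_le (hf : LipschitzWith K f) (x : ℝ) : |deriv f x| ≤ K := by
  simpa using norm_deriv_le_of_lipschitz (x₀ := x) hf

lemma graphSpeed_le (hf : LipschitzWith K f) (x : ℝ) : graphSpeed f x ≤ 1 + K := by
  have h := abs_deriv_le hf x
  unfold graphSpeed
  rw [Real.sqrt_le_left (by positivity)]
  have := sq_abs (deriv f x)
  nlinarith [abs_nonneg (deriv f x)]

lemma intervalIntegrable_deriv (hf : LipschitzWith K f) (a b : ℝ) :
    IntervalIntegrable (deriv f) volume a b :=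
  hf.lipschitzOnWith.absolutelyContinuousOnInterval.intervalIntegrable_deriv

lemma integral_deriv_eq_sub_of_lipschitz (hf : LipschitzWith K f) (a b : ℝ) :
    ∫ x in a..b, deriv f x = f b - f a :=
  hf.lipschitzOnWith.absolutelyContinuousOnInterval.integral_deriv_eq_sub

lemma locallyIntegrable_graphSpeed (hf : LipschitzWith K f) :
    LocallyIntegrable (graphSpeed f) volume := by
  refine (locallyIntegrable_const (1 + K : ℝ)).mono (measurable_graphSpeed f).aestronglyMeasurable
    (Eventually.of_forall fun x => ?_)
  rw [Real.norm_of_nonneg (graphSpeed_pos f x).le, Real.norm_of_nonneg (by positivity)]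
  exact graphSpeed_le hf x

lemma intervalIntegrable_graphSpeed (hf : LipschitzWith K f) (a b : ℝ) :
    IntervalIntegrable (graphSpeed f) volume a b :=
  ((locallyIntegrable_graphSpeed hf).integrableOn_isCompact isCompact_uIcc).intervalIntegrable

/-- A Lipschitz `f` is the integral of its derivative, so the squared chord length is the integral
of the scalar product of the chord with the velocity `(1, f')`; Cauchy–Schwarz bounds it by chord
length times arc length. -/
lemma dist_graphMap_le_integral (hf : LipschitzWith K f) {a b : ℝ} (hab : a ≤ b) :
    dist (graphMap f a) (graphMap f b) ≤ ∫ x in a..b, graphSpeed f x := by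
  set N := dist (graphMap f a) (graphMap f b) with hN
  have hN2 : N ^ 2 = (b - a) ^ 2 + (f b - f a) ^ 2 := by
    rw [hN, plane_dist_eq, Real.sq_sqrt (by positivity)]
    simp only [graphMap_zero, graphMap_one]; ring
  have hI : ∫ x in a..b, ((b - a) + (f b - f a) * deriv f x) = N ^ 2 := by
    rw [intervalIntegral.integral_add (by simp) ((intervalIntegrable_deriv hf a b).const_mul _),
      intervalIntegral.integral_const_mul, integral_deriv_eq_sub_of_lipschitz hf, hN2]
    simp; ring
  have hle : N ^ 2 ≤ N * ∫ x in a..b, graphSpeed f x := by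
    rw [← hI, ← intervalIntegral.integral_const_mul]
    refine intervalIntegral.integral_mono_on hab
      ((by simp : IntervalIntegrable (fun _ => b - a) volume a b).add
        ((intervalIntegrable_deriv hf a b).const_mul _))
      ((intervalIntegrable_graphSpeed hf a b).const_mul _) fun x _ => ?_
    have hN0 : 0 ≤ N := dist_nonneg
    rw [graphSpeed, ← Real.sqrt_sq hN0, ← Real.sqrt_mul (by positivity), hN2]
    refine Real.le_sqrt_of_sq_le ?_
    nlinarith [sq_nonneg ((b - a) * deriv f x - (f b - f a))]
  rcases (dist_nonneg : 0 ≤ N).eq_or_lt with h0 | h0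
  · refine h0.symm.le.trans ?_
    exact intervalIntegral.integral_nonneg hab fun x _ => (graphSpeed_pos f x).le
  · exact le_of_mul_le_mul_left (by rwa [sq] at hle) h0

/-- A map that contracts with respect to an injective change of parameter does not increase
length. -/
lemma hausdorffMeasure_image_le_of_dist_le {γ : ℝ → Plane} {s : ℝ → ℝ} {S : Set ℝ}
    (h : ∀ x ∈ S, ∀ y ∈ S, dist (γ x) (γ y) ≤ dist (s x) (s y)) :
    Measure.hausdorffMeasure (1 : ℝ) (γ '' S) ≤ volume (s '' S) := by
  -- Points of `S` with the same `s`-value have the same image under `γ`, so `γ` factors through `s`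
  -- on `S`, by a 1-Lipschitz map.
  have hinv : ∀ x ∈ S, γ (Function.invFunOn s S (s x)) = γ x := fun x hx => by
    have h1 : s x ∈ s '' S := mem_image_of_mem s hx
    have := h _ (Function.invFunOn_mem h1) x hx
    rw [Function.invFunOn_eq h1, dist_self] at this
    exact dist_le_zero.1 this
  have hlip : LipschitzOnWith 1 (fun r => γ (Function.invFunOn s S r)) (s '' S) := by
    refine LipschitzOnWith.of_dist_le_mul ?_
    rintro _ ⟨x, hx, rfl⟩ _ ⟨y, hy, rfl⟩
    simpa [hinv x hx, hinv y hy] using h x hx y hy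
  have h2 := hlip.hausdorffMeasure_image_le (d := 1) zero_le_one
  rw [image_image, hausdorffMeasure_real] at h2
  have h3 : (fun x => γ (Function.invFunOn s S (s x))) '' S = γ '' S := image_congr hinv
  simpa [h3] using h2

/-- Reparametrization by the arc length function `s` makes the graph 1-Lipschitz, and `s` maps `[a,
b]` into an interval of the right length. -/
lemma hausdorffMeasure_graphMap_image_Icc_le (hf : LipschitzWith K f) (a b : ℝ) :
    Measure.hausdorffMeasure (1 : ℝ) (graphMap f '' Icc a b)
      ≤ ENNReal.ofReal (∫ x in a..b, graphSpeed f x) := by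
  set s : ℝ → ℝ := fun x => ∫ y in a..x, graphSpeed f y with hs
  have hsub : ∀ x y, s y - s x = ∫ r in x..y, graphSpeed f r := fun x y =>
    intervalIntegral.integral_interval_sub_left (intervalIntegrable_graphSpeed hf _ _)
      (intervalIntegrable_graphSpeed hf _ _)
  have hmono : Monotone s := fun x y hxy => by
    rw [← sub_nonneg, hsub]
    exact intervalIntegral.integral_nonneg hxy fun x _ => (graphSpeed_pos f x).le
  have key : ∀ x y, x ≤ y → dist (graphMap f x) (graphMap f y) ≤ dist (s x) (s y) :=
    fun x y hxy => by
      rw [dist_comm (s x), Real.dist_eq, abs_of_nonneg (sub_nonneg.2 (hmono hxy)), hsub]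
      exact dist_graphMap_le_integral hf hxy
  have h1 := hausdorffMeasure_image_le_of_dist_le (γ := graphMap f) (s := s) (S := Icc a b)
    fun x _ y _ => by
      rcases le_total x y with h | h
      · exact key x y h
      · rw [dist_comm, dist_comm (s x)]; exact key y x h
  refine h1.trans ((measure_mono (hmono.image_Icc_subset)).trans ?_)
  rw [Real.volume_Icc, hsub]

/-- The distance to one end point is 1-Lipschitz, and by the intermediate value theorem it takes on
the arc every value up to the chord length. -/
lemma ofReal_dist_le_hausdorffMeasure (hf : Continuous f) {a b : ℝ} (hab : a ≤ b) :
    ENNReal.ofReal (dist (graphMap f b) (graphMap f a))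
      ≤ Measure.hausdorffMeasure (1 : ℝ) (graphMap f '' Icc a b) := by
  have hc : Continuous fun x => dist (graphMap f x) (graphMap f a) :=
    (continuous_graphMap hf).dist continuous_const
  have h1 := intermediate_value_Icc hab hc.continuousOn
  have h2 : LipschitzWith 1 fun p : Plane => dist p (graphMap f a) := LipschitzWith.dist_left _
  have h3 := h2.hausdorffMeasure_image_le (d := 1) zero_le_one (graphMap f '' Icc a b)
  rw [image_image, hausdorffMeasure_real] at h3
  have h4 := (measure_mono (μ := volume) h1).trans h3
  simpa using h4

lemma lipschitzWith_graphMap (hf : LipschitzWith K f) : LipschitzWith (1 + K) (graphMap f) := by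
  refine LipschitzWith.of_dist_le_mul fun x y => ?_
  rw [plane_dist_eq, Real.sqrt_le_left (by positivity)]
  have h1 := hf.dist_le_mul x y
  rw [Real.dist_eq] at h1 ⊢
  rw [Real.dist_eq] at h1
  simp only [graphMap_zero, graphMap_one, NNReal.coe_add, NNReal.coe_one]
  have h2 : (f x - f y) ^ 2 ≤ (K * |x - y|) ^ 2 := sq_le_sq' (by linarith [neg_abs_le (f x - f y)])
    (by linarith [le_abs_self (f x - f y)])
  have h3 : (0 : ℝ) ≤ K * |x - y| ^ 2 := by positivity
  have h4 := sq_abs (x - y)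
  nlinarith

lemma hausdorffMeasure_graphMap_image_le (hf : LipschitzWith K f) (S : Set ℝ) :
    Measure.hausdorffMeasure (1 : ℝ) (graphMap f '' S) ≤ ((1 + K : ℝ≥0) : ENNReal) * volume S := by
  have h2 := (lipschitzWith_graphMap hf).hausdorffMeasure_image_le (d := 1) zero_le_one S
  rwa [hausdorffMeasure_real, ENNReal.rpow_one] at h2

lemma tendsto_dist_graphMap_div {x : ℝ} (hx : DifferentiableAt ℝ f x) :
    Tendsto (fun r => dist (graphMap f (x + r)) (graphMap f (x - r)) / (2 * r)) (𝓝[>] 0)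
      (𝓝 (graphSpeed f x)) := by
  have h1 : HasDerivAt (fun r => f (x + r) - f (x - r)) (2 * deriv f x) 0 := by
    have ha : HasDerivAt (fun r => f (x + r)) (deriv f x) 0 := by
      simpa using HasDerivAt.comp_const_add (f := f) (f' := deriv f x) x 0
        (by simpa using hx.hasDerivAt)
    have hb : HasDerivAt (fun r => f (x - r)) (-deriv f x) 0 := by
      simpa using HasDerivAt.comp_const_sub (f := f) (f' := deriv f x) x 0
        (by simpa using hx.hasDerivAt)
    exact (ha.sub hb).congr_deriv (by ring)
  have h2 := h1.tendsto_slope.mono_left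
    (nhdsWithin_mono (0 : ℝ) fun r (hr : r ∈ Ioi 0) => (mem_Ioi.1 hr).ne')
  have h3 : Tendsto (fun r : ℝ => √(1 + ((f (x + r) - f (x - r)) / (2 * r)) ^ 2)) (𝓝[>] 0)
      (𝓝 (graphSpeed f x)) := by
    have : Tendsto (fun r : ℝ => (f (x + r) - f (x - r)) / (2 * r)) (𝓝[>] 0) (𝓝 (deriv f x)) := by
      have := h2.div_const 2
      simp only [slope_def_field, add_zero, sub_zero, sub_self] at this
      rw [mul_div_cancel_left₀ _ two_ne_zero] at this
      exact this.congr fun r => by rw [div_div, mul_comm r 2]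
    exact ((this.pow 2).const_add 1).sqrt
  refine h3.congr' ?_
  filter_upwards [self_mem_nhdsWithin] with r (hr : 0 < r)
  rw [plane_dist_eq, eq_div_iff (by positivity)]
  nth_rw 2 [← Real.sqrt_sq (show 0 ≤ 2 * r by positivity)]
  rw [← Real.sqrt_mul (by positivity)]
  congr 1
  simp only [graphMap_zero, graphMap_one]
  field_simp
  ring

/-- **Arc length of a Lipschitz graph**: pulled back to the parameter interval,
one-dimensional Hausdorff measure has density `√(1 + f'²)`. -/
theorem comap_graphMap_hausdorffMeasure (hf : LipschitzWith K f) :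
    (Measure.hausdorffMeasure (1 : ℝ)).comap (graphMap f)
      = volume.withDensity fun x => ENNReal.ofReal (graphSpeed f x) := by
  have hemb := measurableEmbedding_graphMap hf.continuous
  set ν := (Measure.hausdorffMeasure (1 : ℝ)).comap (graphMap f) with hν
  set κ := (volume : Measure ℝ).withDensity fun x => ENNReal.ofReal (graphSpeed f x) with hκ
  have hmeas : Measurable fun x => ENNReal.ofReal (graphSpeed f x) :=
    (measurable_graphSpeed f).ennreal_ofReal
  have hνle : ∀ S, ν S ≤ ((1 + K : ℝ≥0) : ENNReal) * volume S := fun S => by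
    rw [hν, hemb.comap_apply]; exact hausdorffMeasure_graphMap_image_le hf S
  have hac : ν ≪ volume := fun S hS => by simpa [hS] using hνle S
  have hκball : ∀ x r, 0 < r → κ (Metric.closedBall x r)
      = ENNReal.ofReal (∫ y in (x - r)..(x + r), graphSpeed f y) := fun x r hr => by
    rw [hκ, withDensity_apply _ Metric.isClosed_closedBall.measurableSet, Real.closedBall_eq_Icc,
      intervalIntegral.integral_of_le (by linarith), ← integral_Icc_eq_integral_Ioc,
      ofReal_integral_eq_lintegral_ofReal]
    · exact (locallyIntegrable_graphSpeed hf).integrableOn_isCompact isCompact_Icc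
    · exact Eventually.of_forall fun x => (graphSpeed_pos f x).le
  have : IsLocallyFiniteMeasure ν := ⟨fun x => ⟨Metric.closedBall x 1,
    Metric.closedBall_mem_nhds x one_pos, (hνle _).trans_lt
      (ENNReal.mul_lt_top (by simp) measure_closedBall_lt_top)⟩⟩
  have : IsLocallyFiniteMeasure κ := ⟨fun x => ⟨Metric.closedBall x 1,
    Metric.closedBall_mem_nhds x one_pos, by rw [hκball x 1 one_pos]; exact ENNReal.ofReal_lt_top⟩⟩
  -- It remains to identify the density, which is almost everywhere the limit of ball quotients. The
  -- quotient of `ν` lies between chord over `2 r` and the quotient of `κ`; both bounds tend to the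
  -- speed.
  rw [← Measure.withDensity_rnDeriv_eq ν volume hac]
  refine withDensity_congr_ae ?_
  filter_upwards [Besicovitch.ae_tendsto_rnDeriv ν volume, Besicovitch.ae_tendsto_rnDeriv κ volume,
    Measure.rnDeriv_withDensity volume hmeas, hf.ae_differentiableAt_real] with x h1 h2 h3 h4
  refine le_antisymm ?_ ?_
  · rw [← h3]
    refine le_of_tendsto_of_tendsto h1 h2 ?_
    filter_upwards [self_mem_nhdsWithin] with r (hr : 0 < r)
    refine ENNReal.div_le_div_right ?_ _
    rw [hκball x r hr, hν, hemb.comap_apply, Real.closedBall_eq_Icc]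
    exact hausdorffMeasure_graphMap_image_Icc_le hf _ _
  · refine le_of_tendsto_of_tendsto
      ((ENNReal.continuous_ofReal.tendsto _).comp (tendsto_dist_graphMap_div h4)) h1 ?_
    filter_upwards [self_mem_nhdsWithin] with r (hr : 0 < r)
    rw [Function.comp, ENNReal.ofReal_div_of_pos (by positivity), Real.volume_closedBall]
    refine ENNReal.div_le_div_right ?_ _
    rw [hν, hemb.comap_apply, Real.closedBall_eq_Icc]
    exact ofReal_dist_le_hausdorffMeasure hf.continuous (by linarith)

/-- Integration with respect to arc length over a Lipschitz graph. -/
theorem integral_range_graphMap (hf : LipschitzWith K f) (G : Plane → ℝ) :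
    ∫ p in range (graphMap f), G p ∂(Measure.hausdorffMeasure (1 : ℝ))
      = ∫ x, graphSpeed f x * G (graphMap f x) := by
  have hemb := measurableEmbedding_graphMap hf.continuous
  rw [← hemb.map_comap, hemb.integral_map, comap_graphMap_hausdorffMeasure hf,
    integral_withDensity_eq_integral_toReal_smul (measurable_graphSpeed f).ennreal_ofReal
      (Eventually.of_forall fun _ => ENNReal.ofReal_lt_top)]
  simp [ENNReal.toReal_ofReal (graphSpeed_pos f _).le]

end ShallowWater

namespace ShallowWater

/-! ### Integration by parts below a Lipschitz graph -/

variable {f : ℝ → ℝ} {K : ℝ≥0}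

lemma graphMap_eq (f : ℝ → ℝ) (x : ℝ) :
    graphMap f x = x • EuclideanSpace.single 0 1 + f x • EuclideanSpace.single 1 1 := by
  ext i; fin_cases i <;> simp [graphMap]

lemma plane_eq (e : Plane) :
    e = e 0 • EuclideanSpace.single 0 1 + e 1 • EuclideanSpace.single 1 1 := by
  ext i; fin_cases i <;> simp

/-- A locally Lipschitz function is Lipschitz on a compact interval around its support, hence
absolutely continuous there. -/
lemma integral_deriv_eq_zero_of_locallyLipschitz {g : ℝ → ℝ} (hg : LocallyLipschitz g)
    (hsupp : HasCompactSupport g) : ∫ x, deriv g x = 0 := by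
  obtain ⟨R, hR0, hR⟩ := hsupp.isCompact.isBounded.subset_ball_lt 0 (0 : ℝ)
  have hR' : tsupport g ⊆ Ioo (-R) R := by simpa [Real.ball_eq_Ioo] using hR
  obtain ⟨C, hC⟩ := (hg.locallyLipschitzOn (s := uIcc (-R) R)).exists_lipschitzOnWith_of_compact
    isCompact_uIcc
  have h1 := hC.absolutelyContinuousOnInterval.integral_deriv_eq_sub
  have hz : ∀ x, x ∉ Ioo (-R) R → g x = 0 := fun x hx =>
    image_eq_zero_of_notMem_tsupport fun h => hx (hR' h)
  rw [hz R (by simp), hz (-R) (by simp), sub_zero] at h1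
  rw [← h1, intervalIntegral.integral_eq_integral_of_support_subset]
  exact (support_deriv_subset).trans (hR'.trans Ioo_subset_Ioc_self)

/-- The coordinates of the plane in which the subgraph of `f` is a half-plane. -/
noncomputable def shearMap (f : ℝ → ℝ) (q : ℝ × ℝ) : Plane := graphMap (fun x => f x + q.2) q.1

lemma continuous_shearMap (hf : Continuous f) : Continuous (shearMap f) := by
  unfold shearMap graphMap
  fun_prop

lemma injective_shearMap (f : ℝ → ℝ) : Function.Injective (shearMap f) := fun p q h => by
  have h0 : p.1 = q.1 := congrArg (fun p : Plane => p 0) h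
  have h1 : f p.1 + p.2 = f q.1 + q.2 := congrArg (fun p : Plane => p 1) h
  rw [h0] at h1
  exact Prod.ext h0 (add_left_cancel h1)

lemma measurableEmbedding_shearMap (hf : Continuous f) : MeasurableEmbedding (shearMap f) :=
  (continuous_shearMap hf).measurableEmbedding (injective_shearMap f)

/-- Each vertical line is merely translated, so no differentiability of `f` is needed for the change
of variables. -/
lemma measurePreserving_shearMap (hf : Continuous f) :
    MeasurePreserving (shearMap f) (volume : Measure (ℝ × ℝ)) volume := by
  have h1 : MeasurePreserving (fun q : ℝ × ℝ => (q.1, f q.1 + q.2)) volume volume :=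
    (MeasurePreserving.id volume).skew_product (g := fun a c => f a + c)
      (by fun_prop) (Eventually.of_forall fun x => map_add_left_eq_self volume (f x))
  have h2 := (PiLp.volume_preserving_toLp (Fin 2)).comp
    ((volume_preserving_finTwoArrow ℝ).symm.comp h1)
  exact h2

lemma shearMap_eq (f : ℝ → ℝ) (x s : ℝ) :
    shearMap f (x, s) = graphMap f x + s • EuclideanSpace.single 1 1 := by
  simp [shearMap, graphMap_eq, add_smul, add_assoc]

section

variable {h : Plane → ℝ} {C : ℝ}

lemma isOpen_subgraph (hf : Continuous f) : IsOpen {p : Plane | p 1 < f (p 0)} :=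
  isOpen_lt (by fun_prop) (by fun_prop)

lemma integrable_fderiv_shearMap (hf : Continuous f) (hsupp : HasCompactSupport h)
    (hC : ∀ p : Plane, p 1 < f (p 0) → ‖fderiv ℝ h p‖ ≤ C) (e : Plane) :
    Integrable (fun q => fderiv ℝ h (shearMap f q) e)
      ((volume : Measure ℝ).prod (volume.restrict (Iio 0))) := by
  have hpre : shearMap f ⁻¹' {p : Plane | p 1 < f (p 0)} = univ ×ˢ Iio 0 := by
    ext ⟨x, s⟩; simp [shearMap]
  have h1 : IntegrableOn (fun p => fderiv ℝ h p e) {p : Plane | p 1 < f (p 0)} := by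
    have h2 : IntegrableOn (fun p => fderiv ℝ h p e)
        ({p : Plane | p 1 < f (p 0)} ∩ tsupport h) := by
      refine IntegrableOn.of_bound ((measure_mono inter_subset_right).trans_lt
        hsupp.isCompact.measure_lt_top) (measurable_fderiv_apply_const ℝ h e).aestronglyMeasurable
        (C * ‖e‖) ?_
      refine ae_restrict_of_forall_mem ((isOpen_subgraph hf).measurableSet.inter
        (isClosed_tsupport h).measurableSet) fun p hp => ?_
      exact (ContinuousLinearMap.le_opNorm _ _).trans (by gcongr; exact hC p hp.1)
    refine h2.of_forall_sdiff_eq_zero (isOpen_subgraph hf).measurableSet fun p hp => ?_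
    have : p ∉ tsupport h := fun h => hp.2 ⟨hp.1, h⟩
    have h3 : fderiv ℝ h p = 0 := by
      by_contra h0
      exact this (support_fderiv_subset ℝ h0)
    simp [h3]
  rw [← (measurePreserving_shearMap hf).integrableOn_comp_preimage
    (measurableEmbedding_shearMap hf), hpre] at h1
  rwa [IntegrableOn, Measure.volume_eq_prod, ← Measure.prod_restrict, Measure.restrict_univ] at h1

lemma hasDerivAt_graphMap {x : ℝ} (hx : DifferentiableAt ℝ f x) :
    HasDerivAt (graphMap f)
      (EuclideanSpace.single 0 1 + deriv f x • EuclideanSpace.single 1 1) x := by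
  have : graphMap f = fun x =>
      x • EuclideanSpace.single 0 1 + f x • EuclideanSpace.single 1 1 := funext (graphMap_eq f)
  rw [this]
  have h1 := ((hasDerivAt_id' x).smul_const (EuclideanSpace.single 0 (1 : ℝ) : Plane)).add
    (hx.hasDerivAt.smul_const (EuclideanSpace.single 1 (1 : ℝ) : Plane))
  rw [one_smul] at h1
  exact h1

/-- The integrand is almost everywhere the derivative of `h` along the graph lowered by `|s|`. That
curve stays in the open subgraph, where each point has a ball on which `h` is Lipschitz, so the
restriction of `h` is locally Lipschitz with compact support. -/
lemma integral_fderiv_shearMap_tangent (hf : LipschitzWith K f) (hsupp : HasCompactSupport h)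
    (hdiff : ∀ p : Plane, p 1 < f (p 0) → DifferentiableAt ℝ h p)
    (hC : ∀ p : Plane, p 1 < f (p 0) → ‖fderiv ℝ h p‖ ≤ C) {s : ℝ} (hs : s < 0) :
    ∫ x, fderiv ℝ h (shearMap f (x, s))
      (EuclideanSpace.single 0 1 + deriv f x • EuclideanSpace.single 1 1) = 0 := by
  have hfs : LipschitzWith K fun x => f x + s := by
    simpa using hf.add (LipschitzWith.const s)
  have hmem : ∀ x, graphMap (fun x => f x + s) x ∈ {p : Plane | p 1 < f (p 0)} := fun x => by
    simpa using hs
  have hderiv : ∀ᵐ x, fderiv ℝ h (shearMap f (x, s))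
      (EuclideanSpace.single 0 1 + deriv f x • EuclideanSpace.single 1 1)
        = deriv (fun x => h (graphMap (fun x => f x + s) x)) x := by
    filter_upwards [hf.ae_differentiableAt_real] with x hx
    have h1 := hasDerivAt_graphMap (f := fun x => f x + s) (x := x) (by fun_prop)
    have h2 := (hdiff _ (hmem x)).hasFDerivAt.comp_hasDerivAt x h1
    rw [deriv_add_const] at h2
    exact h2.deriv.symm
  rw [integral_congr_ae hderiv]
  refine integral_deriv_eq_zero_of_locallyLipschitz ?_ ?_
  · intro x
    obtain ⟨r, hr, hball⟩ := Metric.isOpen_iff.1 (isOpen_subgraph hf.continuous) _ (hmem x)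
    have hlip : LipschitzOnWith C.toNNReal h
        (Metric.ball (graphMap (fun x => f x + s) x) r) :=
      (convex_ball _ _).lipschitzOnWith_of_nnnorm_fderiv_le (fun p hp => hdiff p (hball hp))
        fun p hp => by
          rw [← NNReal.coe_le_coe]
          exact (hC p (hball hp)).trans (Real.le_coe_toNNReal C)
    refine ⟨_, _, (continuous_graphMap hfs.continuous).continuousAt.preimage_mem_nhds
      (Metric.ball_mem_nhds _ hr), hlip.comp (lipschitzWith_graphMap hfs).lipschitzOnWith ?_⟩
    exact fun y hy => hy
  · refine HasCompactSupport.intro' (hsupp.isCompact.image (f := fun p : Plane => p 0)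
      (by fun_prop)) (hsupp.isCompact.image (by fun_prop)).isClosed fun x hx => ?_
    exact image_eq_zero_of_notMem_tsupport fun hmem' => hx ⟨_, hmem', rfl⟩

/-- Fundamental theorem of calculus on a vertical half-line: continuity of `h` up to the graph gives
the value at the top, and compact support gives zero at the bottom. -/
lemma integral_fderiv_shearMap_vertical (hf : Continuous f) (hsupp : HasCompactSupport h)
    (hcont : ContinuousOn h {p : Plane | p 1 ≤ f (p 0)})
    (hdiff : ∀ p : Plane, p 1 < f (p 0) → DifferentiableAt ℝ h p) {x : ℝ}
    (hint : Integrable (fun s => fderiv ℝ h (shearMap f (x, s)) (EuclideanSpace.single 1 1))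
      (volume.restrict (Iio 0))) :
    ∫ s in Iio 0, fderiv ℝ h (shearMap f (x, s)) (EuclideanSpace.single 1 1)
      = h (graphMap f x) := by
  have hΨ : Continuous fun s => shearMap f (x, s) :=
    (continuous_shearMap hf).comp (by fun_prop)
  rw [← integral_Iic_eq_integral_Iio]
  have h0 : h (shearMap f (x, 0)) - 0 = h (graphMap f x) := by simp [shearMap]
  rw [← h0]
  refine integral_Iic_of_hasDerivAt_of_tendsto (f := fun s => h (shearMap f (x, s))) ?_ ?_ ?_ ?_
  · have h1 : ContinuousWithinAt h {p : Plane | p 1 ≤ f (p 0)} (shearMap f (x, 0)) :=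
      hcont _ (by simp [shearMap])
    exact h1.comp (f := fun s => shearMap f (x, s)) hΨ.continuousWithinAt
      fun s hs => by simpa [shearMap] using hs
  · intro s hs
    have h1 : HasDerivAt (fun s => shearMap f (x, s)) (EuclideanSpace.single 1 1) s := by
      simp only [shearMap_eq]
      simpa using ((hasDerivAt_id s).smul_const
        (EuclideanSpace.single 1 (1 : ℝ) : Plane)).const_add (graphMap f x)
    exact (hdiff _ (by simpa [shearMap] using hs)).hasFDerivAt.comp_hasDerivAt s h1
  · rwa [IntegrableOn, ← restrict_Iio_eq_restrict_Iic]
  · refine tendsto_const_nhds.congr' ?_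
    have hK := (hsupp.isCompact.image (f := fun p : Plane => p 1) (by fun_prop)).bddBelow
    obtain ⟨m, hm⟩ := hK
    filter_upwards [eventually_lt_atBot (m - f x)] with s hs
    refine (image_eq_zero_of_notMem_tsupport fun hmem => ?_).symm
    have := hm ⟨_, hmem, rfl⟩
    simp only [shearMap, graphMap_one] at this
    linarith

/-- **Divergence theorem below a Lipschitz graph**, for compactly supported functions that are
continuous up to the graph and have a bounded derivative below it. -/
theorem integral_subgraph_fderiv (hf : LipschitzWith K f) (hsupp : HasCompactSupport h)
    (hcont : ContinuousOn h {p : Plane | p 1 ≤ f (p 0)})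
    (hdiff : ∀ p : Plane, p 1 < f (p 0) → DifferentiableAt ℝ h p)
    (hC : ∀ p : Plane, p 1 < f (p 0) → ‖fderiv ℝ h p‖ ≤ C) (e : Plane) :
    ∫ p in {p : Plane | p 1 < f (p 0)}, fderiv ℝ h p e
      = ∫ x, (e 1 - deriv f x * e 0) * h (graphMap f x) := by
  have hpre : shearMap f ⁻¹' {p : Plane | p 1 < f (p 0)} = univ ×ˢ Iio 0 := by
    ext ⟨x, s⟩; simp [shearMap]
  have hI := fun e => integrable_fderiv_shearMap hf.continuous hsupp hC e
  set e₀ : Plane := EuclideanSpace.single 0 1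
  set e₁ : Plane := EuclideanSpace.single 1 1
  have hbdd : ∀ᵐ q ∂((volume : Measure ℝ).prod (volume.restrict (Iio (0 : ℝ)))),
      ‖deriv f q.1‖ ≤ K := Eventually.of_forall fun q => abs_deriv_le hf q.1
  have hmeas : AEStronglyMeasurable (fun q : ℝ × ℝ => deriv f q.1)
      ((volume : Measure ℝ).prod (volume.restrict (Iio (0 : ℝ)))) :=
    ((measurable_deriv f).comp measurable_fst).aestronglyMeasurable
  have hI' : Integrable (fun q : ℝ × ℝ => deriv f q.1 * fderiv ℝ h (shearMap f q) e₁)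
      ((volume : Measure ℝ).prod (volume.restrict (Iio 0))) := (hI e₁).bdd_mul hmeas hbdd
  have hIt : Integrable (fun q : ℝ × ℝ => fderiv ℝ h (shearMap f q) (e₀ + deriv f q.1 • e₁))
      ((volume : Measure ℝ).prod (volume.restrict (Iio 0))) := by
    refine ((hI e₀).add hI').congr (Eventually.of_forall fun q => ?_)
    simp only [Pi.add_apply, map_add, map_smul, smul_eq_mul]
  have hIn : Integrable (fun q : ℝ × ℝ =>
      (e 1 - deriv f q.1 * e 0) * fderiv ℝ h (shearMap f q) e₁)
      ((volume : Measure ℝ).prod (volume.restrict (Iio 0))) :=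
    (((hI e₁).const_mul (e 1)).sub (hI'.const_mul (e 0))).congr
      (Eventually.of_forall fun q => by simp only [Pi.sub_apply]; ring)
  rw [← (measurePreserving_shearMap hf.continuous).setIntegral_preimage_emb
    (measurableEmbedding_shearMap hf.continuous), hpre, Measure.volume_eq_prod,
    ← Measure.prod_restrict, Measure.restrict_univ]
  -- Split `e` into a multiple of the tangent `e₀ + f' e₁` of the graph and a vertical remainder.
  -- The former coefficient is constant, the latter depends on the horizontal coordinate only, so
  -- both leave their inner integrals.
  have hsplit : ∀ q : ℝ × ℝ, fderiv ℝ h (shearMap f q) e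
      = e 0 * fderiv ℝ h (shearMap f q) (e₀ + deriv f q.1 • e₁)
        + (e 1 - deriv f q.1 * e 0) * fderiv ℝ h (shearMap f q) e₁ := fun q => by
    conv_lhs => rw [plane_eq e]
    simp only [map_add, map_smul, smul_eq_mul]
    ring
  simp only [hsplit]
  -- Opposite orders of Fubini: the tangential part is integrated along the graph direction first,
  -- the vertical part along the vertical first.
  rw [integral_add (hIt.const_mul _) hIn, integral_const_mul, integral_prod_symm _ hIt,
    setIntegral_congr_fun measurableSet_Iio (g := fun _ => (0 : ℝ)) fun s hs =>
      integral_fderiv_shearMap_tangent hf hsupp hdiff hC hs, integral_prod _ hIn]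
  simp only [integral_zero, mul_zero, zero_add]
  refine integral_congr_ae ?_
  filter_upwards [(hI e₁).prod_right_ae] with x hx
  rw [integral_const_mul, integral_fderiv_shearMap_vertical hf.continuous hsupp hcont hdiff hx]

end

end ShallowWater

namespace ShallowWater

/-! ### Graph charts of a Lipschitz domain -/

/-- On the open set `U`, and in the Cartesian coordinates `A`, the set `Ω` is the subgraph of the
Lipschitz function `f`. -/
structure IsGraphChart (Ω U : Set Plane) (A : Plane ≃ᵃⁱ[ℝ] Plane) (f : ℝ → ℝ) (K : ℝ≥0) :
    Prop where
  isOpen : IsOpen U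
  lipschitz : LipschitzWith K f
  mem_iff : ∀ x ∈ U, x ∈ Ω ↔ A x 1 < f (A x 0)

/-- The chart is shrunk into a unit ball so that functions localized in it have compact support. -/
lemma IsBoundedLipschitzDomain.exists_chart {Ω : Set Plane} (hΩ : IsBoundedLipschitzDomain Ω)
    {x₀ : Plane} (hx₀ : x₀ ∈ frontier Ω) :
    ∃ U A f K, x₀ ∈ U ∧ U ⊆ Metric.ball x₀ 1 ∧ IsGraphChart Ω U A f K := by
  obtain ⟨A, f, K, hf, hev⟩ := hΩ.lipschitz_boundary x₀ hx₀
  obtain ⟨U, hU, hUo, hxU⟩ := eventually_nhds_iff.1 hev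
  exact ⟨U ∩ Metric.ball x₀ 1, A, f, K, ⟨hxU, Metric.mem_ball_self one_pos⟩, inter_subset_right,
    hUo.inter Metric.isOpen_ball, hf, fun x hx => hU x hx.1⟩

lemma IsBoundedLipschitzDomain.isCompact_closure {Ω : Set Plane}
    (hΩ : IsBoundedLipschitzDomain Ω) : IsCompact (closure Ω) :=
  hΩ.isBounded.isCompact_closure

lemma IsBoundedLipschitzDomain.isCompact_frontier {Ω : Set Plane}
    (hΩ : IsBoundedLipschitzDomain Ω) : IsCompact (frontier Ω) :=
  hΩ.isCompact_closure.of_isClosed_subset isClosed_frontier frontier_subset_closure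

lemma affineIsometry_sub (A : Plane ≃ᵃⁱ[ℝ] Plane) (x y : Plane) :
    A x - A y = A.linearIsometryEquiv (x - y) := by
  simpa using (A.map_vsub x y).symm

lemma measurePreserving_affineIsometry (A : Plane ≃ᵃⁱ[ℝ] Plane) :
    MeasurePreserving A (volume : Measure Plane) volume := by
  have h : (A : Plane → Plane) = (fun x => x + A 0) ∘ A.linearIsometryEquiv := by
    funext x
    have := affineIsometry_sub A x 0
    rw [sub_zero] at this
    rw [Function.comp, ← this, sub_add_cancel]
  rw [h]
  exact (measurePreserving_add_right volume (A 0)).comp A.linearIsometryEquiv.measurePreserving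

lemma measurePreserving_affineIsometry_hausdorffMeasure (A : Plane ≃ᵃⁱ[ℝ] Plane) :
    MeasurePreserving A (Measure.hausdorffMeasure (1 : ℝ)) (Measure.hausdorffMeasure (1 : ℝ)) :=
  A.toIsometryEquiv.measurePreserving_hausdorffMeasure 1

lemma measurableEmbedding_affineIsometry (A : Plane ≃ᵃⁱ[ℝ] Plane) : MeasurableEmbedding A :=
  A.toHomeomorph.measurableEmbedding

lemma mem_range_graphMap_iff {f : ℝ → ℝ} {p : Plane} : p ∈ range (graphMap f) ↔ p 1 = f (p 0) := by
  constructor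
  · rintro ⟨x, rfl⟩; simp
  · intro h
    refine ⟨p 0, ?_⟩
    ext i; fin_cases i
    · rfl
    · exact h.symm

/-- The upward unit normal of the graph of `f`. -/
noncomputable def graphNormal (f : ℝ → ℝ) (x : ℝ) : Plane :=
  (graphSpeed f x)⁻¹ • !₂[-deriv f x, 1]

lemma norm_graphNormal (f : ℝ → ℝ) (x : ℝ) : ‖graphNormal f x‖ = 1 := by
  have h : ‖(!₂[-deriv f x, 1] : Plane)‖ = graphSpeed f x := by
    rw [EuclideanSpace.norm_eq, graphSpeed]
    simp [Fin.sum_univ_two, add_comm]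
  rw [graphNormal, norm_smul, h, norm_inv, Real.norm_of_nonneg (graphSpeed_pos f x).le,
    inv_mul_cancel₀ (graphSpeed_pos f x).ne']

lemma graphSpeed_mul_inner_graphNormal (f : ℝ → ℝ) (x : ℝ) (v : Plane) :
    graphSpeed f x * inner ℝ v (graphNormal f x) = v 1 - deriv f x * v 0 := by
  rw [graphNormal, inner_smul_right, mul_inv_cancel_left₀ (graphSpeed_pos f x).ne']
  simp [PiLp.inner_apply, Fin.sum_univ_two]
  ring

lemma measurable_graphNormal (f : ℝ → ℝ) : Measurable (graphNormal f) := by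
  unfold graphNormal
  refine (measurable_graphSpeed f).inv.smul ?_
  have : Measurable fun x => (![-deriv f x, 1] : Fin 2 → ℝ) := by
    refine measurable_pi_iff.2 fun i => ?_
    fin_cases i
    · exact (measurable_deriv f).neg
    · exact measurable_const
  exact (PiLp.continuous_toLp 2 _).measurable.comp this

/-- For distinct normals, a short step from `x` in the direction `ν' - ν` would land inside `Ω`
according to `ν` and outside according to `ν'`. -/
lemma IsUnitOutwardNormal.unique {Ω : Set Plane} {x ν ν' : Plane}
    (h : IsUnitOutwardNormal Ω x ν) (h' : IsUnitOutwardNormal Ω x ν') : ν = ν' := by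
  by_contra hne
  have hc : inner ℝ ν ν' < 1 := (inner_lt_one_iff_real_of_norm_eq_one h.1 h'.1).2 hne
  set c := inner ℝ ν ν' with hcdef
  have h1 : inner ℝ (ν' - ν) ν = c - 1 := by
    rw [inner_sub_left, real_inner_self_eq_norm_sq, h.1, real_inner_comm]; norm_num [hcdef]
  have h2 : inner ℝ (ν' - ν) ν' = 1 - c := by
    rw [inner_sub_left, real_inner_self_eq_norm_sq, h'.1]; norm_num [hcdef]
  have hd : ‖ν' - ν‖ ≤ 2 := (norm_sub_le _ _).trans (by rw [h.1, h'.1]; norm_num)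
  -- The step has length at most `2 r` and its scalar products with the normals are `∓ r (1 - c)`;
  -- this `ε` makes the tolerance at most half of `r (1 - c)`.
  set ε := (1 - c) / 4 with hε
  have hεpos : 0 < ε := by rw [hε]; linarith
  have hlim : Tendsto (fun r : ℝ => x + r • (ν' - ν)) (𝓝[>] 0) (𝓝 x) := by
    have : Continuous fun r : ℝ => x + r • (ν' - ν) := by fun_prop
    simpa using (this.tendsto 0).mono_left nhdsWithin_le_nhds
  obtain ⟨r, ⟨ha, hb⟩, hr⟩ := ((hlim.eventually ((h.2 ε hεpos).and (h'.2 ε hεpos))).and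
    self_mem_nhdsWithin).exists
  have hr : 0 < r := hr
  simp only [add_sub_cancel_left, inner_smul_left, norm_smul, h1, h2, Real.norm_eq_abs,
    abs_of_pos hr, RCLike.conj_to_real] at ha hb
  have hle : ε * (r * ‖ν' - ν‖) < r * (1 - c) := by
    have : ε * (r * ‖ν' - ν‖) ≤ ε * (r * 2) := by gcongr
    have h4 : ε * (r * 2) = r * (1 - c) / 2 := by rw [hε]; ring
    have : 0 < r * (1 - c) := mul_pos hr (by linarith)
    linarith
  exact hb.2 hle (ha.1 (by linarith))

lemma IsUnitOutwardNormal.outwardNormal_eq {Ω : Set Plane} {x ν : Plane}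
    (h : IsUnitOutwardNormal Ω x ν) : outwardNormal Ω x = ν := by
  have hex : ∃ ν, IsUnitOutwardNormal Ω x ν := ⟨ν, h⟩
  rw [outwardNormal, dif_pos hex]
  exact hex.choose_spec.unique h

lemma norm_outwardNormal_le (Ω : Set Plane) (x : Plane) : ‖outwardNormal Ω x‖ ≤ 1 := by
  by_cases h : ∃ ν, IsUnitOutwardNormal Ω x ν
  · obtain ⟨ν, hν⟩ := h
    rw [hν.outwardNormal_eq, hν.1]
  · rw [outwardNormal, dif_neg h]; simp

/-! ### Closure, boundary, normal and boundary integrals in a single chart -/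

namespace IsGraphChart

variable {Ω U : Set Plane} {A : Plane ≃ᵃⁱ[ℝ] Plane} {f : ℝ → ℝ} {K : ℝ≥0}

lemma continuous_graph_height (hc : IsGraphChart Ω U A f K) : Continuous fun x => f (A x 0) := by
  have := hc.lipschitz.continuous
  have := A.continuous
  fun_prop

lemma mem_closure_iff (hc : IsGraphChart Ω U A f K) {x : Plane} (hx : x ∈ U) :
    x ∈ closure Ω ↔ A x 1 ≤ f (A x 0) := by
  have hA := A.continuous
  constructor
  · intro h
    by_contra! hlt
    have hV : IsOpen (U ∩ {y | f (A y 0) < A y 1}) :=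
      hc.isOpen.inter (isOpen_lt hc.continuous_graph_height (by fun_prop))
    obtain ⟨y, ⟨hyU, hy⟩, hyΩ⟩ := _root_.mem_closure_iff.1 h _ hV ⟨hx, hlt⟩
    exact lt_asymm hy ((hc.mem_iff y hyU).1 hyΩ)
  · intro h
    set y : ℝ → Plane := fun s => A.symm (A x - s • EuclideanSpace.single 1 1) with hy
    have hcont : Continuous y := A.symm.continuous.comp (by fun_prop)
    have hlim : Tendsto y (𝓝[>] 0) (𝓝 x) := by
      have := (hcont.tendsto 0).mono_left (nhdsWithin_le_nhds (s := Ioi (0 : ℝ)))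
      simpa [hy] using this
    refine mem_closure_of_tendsto hlim ?_
    filter_upwards [hlim (hc.isOpen.mem_nhds hx), self_mem_nhdsWithin] with s hs (hs0 : 0 < s)
    refine (hc.mem_iff _ hs).2 ?_
    simp only [hy, AffineIsometryEquiv.apply_symm_apply]
    simp
    linarith

lemma mem_frontier_iff (hc : IsGraphChart Ω U A f K) (hΩ : IsOpen Ω) {x : Plane} (hx : x ∈ U) :
    x ∈ frontier Ω ↔ A x 1 = f (A x 0) := by
  rw [hΩ.frontier_eq, Set.mem_sdiff, hc.mem_closure_iff hx, hc.mem_iff x hx, not_lt]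
  exact le_antisymm_iff.symm

/-- First-order expansion of `f` at the point. The length element is at least 1, so the tolerance
`ε` of the expansion also serves for the unit normal. -/
lemma isUnitOutwardNormal (hc : IsGraphChart Ω U A f K) {x : Plane} (hx : x ∈ U)
    (hxf : A x 1 = f (A x 0)) (hd : DifferentiableAt ℝ f (A x 0)) :
    IsUnitOutwardNormal Ω x (A.linearIsometryEquiv.symm (graphNormal f (A x 0))) := by
  refine ⟨by rw [LinearIsometryEquiv.norm_map, norm_graphNormal], fun ε hε => ?_⟩
  set a := A x 0 with ha
  have hsmall : ∀ᶠ y in 𝓝 x, |f (A y 0) - f a - (A y 0 - a) * deriv f a| ≤ ε * |A y 0 - a| := by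
    have hlim : Tendsto (fun y => A y 0) (𝓝 x) (𝓝 a) := by
      have : Continuous fun y => A y 0 := by have := A.continuous; fun_prop
      exact this.tendsto x
    have := hlim.eventually ((hasDerivAt_iff_isLittleO.1 hd.hasDerivAt).def hε)
    simpa using this
  filter_upwards [hsmall, hc.isOpen.mem_nhds hx] with y hy hyU
  set v := A y - A x with hv
  have hin : inner ℝ (y - x) (A.linearIsometryEquiv.symm (graphNormal f a))
      = inner ℝ v (graphNormal f a) := by
    rw [hv, affineIsometry_sub, ← LinearIsometryEquiv.inner_map_map A.linearIsometryEquiv,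
      LinearIsometryEquiv.apply_symm_apply]
  have hnorm : ‖y - x‖ = ‖v‖ := by rw [hv, affineIsometry_sub, LinearIsometryEquiv.norm_map]
  have hkey := graphSpeed_mul_inner_graphNormal f a v
  have hs1 : 1 ≤ graphSpeed f a := by
    rw [graphSpeed]; exact Real.one_le_sqrt.2 (by nlinarith [sq_nonneg (deriv f a)])
  have hv0 : A y 0 - a = v 0 := by simp [hv, ha]
  have hv1 : A y 1 = f a + v 1 := by simp [hv, ← hxf]
  have hvle : |v 0| ≤ ‖v‖ := by simpa using PiLp.norm_apply_le v 0
  rw [hin, hnorm, hc.mem_iff y hyU, hv1]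
  rw [hv0, abs_le] at hy
  have h1 : ε * |v 0| ≤ ε * ‖v‖ := by gcongr
  have h2 : ε * ‖v‖ ≤ graphSpeed f a * (ε * ‖v‖) := le_mul_of_one_le_left (by positivity) hs1
  constructor
  · intro h
    have h3 := mul_lt_mul_of_pos_left h (graphSpeed_pos f a)
    rw [hkey] at h3
    linarith [hy.1]
  · intro h
    have h3 := mul_lt_mul_of_pos_left h (graphSpeed_pos f a)
    rw [hkey] at h3
    rw [not_lt]
    linarith [hy.2]

/-- By Rademacher's theorem the exceptional points lie in the image of a null set of parameters
under a Lipschitz map, which has length zero. -/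
lemma ae_isUnitOutwardNormal (hc : IsGraphChart Ω U A f K) (hΩ : IsOpen Ω) :
    ∀ᵐ x ∂(Measure.hausdorffMeasure (1 : ℝ)).restrict (frontier Ω ∩ U),
      IsUnitOutwardNormal Ω x (A.linearIsometryEquiv.symm (graphNormal f (A x 0))) := by
  rw [ae_restrict_iff' (isClosed_frontier.measurableSet.inter hc.isOpen.measurableSet)]
  have hN : volume {a | ¬ DifferentiableAt ℝ f a} = 0 := hc.lipschitz.ae_differentiableAt_real
  have hN' : Measure.hausdorffMeasure (1 : ℝ)
      (A ⁻¹' (graphMap f '' {a | ¬ DifferentiableAt ℝ f a})) = 0 := by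
    rw [(measurePreserving_affineIsometry_hausdorffMeasure A).measure_preimage_emb
      (measurableEmbedding_affineIsometry A)]
    have := hausdorffMeasure_graphMap_image_le hc.lipschitz {a | ¬ DifferentiableAt ℝ f a}
    simpa [hN] using this
  refine measure_mono_null (fun x hx => ?_) hN'
  simp only [mem_compl_iff, mem_ofPred_eq, Classical.not_imp] at hx
  obtain ⟨⟨hxf, hxU⟩, hx⟩ := hx
  have hxf' := (hc.mem_frontier_iff hΩ hxU).1 hxf
  obtain ⟨a, ha⟩ := mem_range_graphMap_iff.2 hxf'
  refine ⟨a, fun hd => hx (hc.isUnitOutwardNormal hxU hxf' ?_), ha⟩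
  rwa [← ha, graphMap_zero]

/-- `outwardNormal` is defined by choice; its measurability comes from the almost everywhere equal
formula in the chart. -/
lemma aestronglyMeasurable_outwardNormal (hc : IsGraphChart Ω U A f K) (hΩ : IsOpen Ω) :
    AEStronglyMeasurable (outwardNormal Ω)
      ((Measure.hausdorffMeasure (1 : ℝ)).restrict (frontier Ω ∩ U)) := by
  have hm : Measurable fun x => A.linearIsometryEquiv.symm (graphNormal f (A x 0)) := by
    refine A.linearIsometryEquiv.symm.continuous.measurable.comp
      ((measurable_graphNormal f).comp ?_)
    have : Continuous fun y => A y 0 := by have := A.continuous; fun_prop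
    exact this.measurable
  refine hm.aestronglyMeasurable.congr ?_
  filter_upwards [hc.ae_isUnitOutwardNormal hΩ] with x hx
  exact hx.outwardNormal_eq.symm

/-- A boundary integral in a chart. -/
lemma integral_frontier (hc : IsGraphChart Ω U A f K) (hΩ : IsOpen Ω) {G : Plane → ℝ}
    (hG : ∀ x ∉ U, G x = 0) (e : Plane) :
    ∫ x in frontier Ω, G x * inner ℝ e (outwardNormal Ω x) ∂(Measure.hausdorffMeasure (1 : ℝ))
      = ∫ a, (A.linearIsometryEquiv e 1 - deriv f a * A.linearIsometryEquiv e 0)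
          * G (A.symm (graphMap f a)) := by
  set F : Plane → ℝ := fun x => G x * inner ℝ e (outwardNormal Ω x) with hF
  have hF0 : ∀ x ∉ U, F x = 0 := fun x hx => by simp [hF, hG x hx]
  have hemb := measurableEmbedding_affineIsometry A
  have hrm : MeasurableSet (A ⁻¹' range (graphMap f)) :=
    hemb.measurable (measurableEmbedding_graphMap hc.lipschitz.continuous).measurableSet_range
  have h1 : ∫ x in frontier Ω, F x ∂(Measure.hausdorffMeasure (1 : ℝ))
      = ∫ x in A ⁻¹' range (graphMap f), F x ∂(Measure.hausdorffMeasure (1 : ℝ)) := by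
    -- The boundary and the full graph agree only inside `U`, which suffices since the integrand
    -- vanishes elsewhere.
    have hset : frontier Ω ∩ U = A ⁻¹' range (graphMap f) ∩ U := by
      ext x
      simp only [mem_inter_iff, mem_preimage, mem_range_graphMap_iff, and_congr_left_iff]
      exact fun hx => hc.mem_frontier_iff hΩ hx
    rw [setIntegral_eq_of_subset_of_forall_sdiff_eq_zero isClosed_frontier.measurableSet
      (inter_subset_left (s := frontier Ω) (t := U)) fun x hx => hF0 x fun hU => hx.2 ⟨hx.1, hU⟩,
      hset, ← setIntegral_eq_of_subset_of_forall_sdiff_eq_zero hrm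
      (inter_subset_left (t := U)) fun x hx => hF0 x fun hU => hx.2 ⟨hx.1, hU⟩]
  have h2 := (measurePreserving_affineIsometry_hausdorffMeasure A).setIntegral_preimage_emb hemb
    (fun p => F (A.symm p)) (range (graphMap f))
  simp only [AffineIsometryEquiv.symm_apply_apply] at h2
  rw [h1, h2, integral_range_graphMap hc.lipschitz]
  refine integral_congr_ae ?_
  filter_upwards [hc.lipschitz.ae_differentiableAt_real] with a ha
  by_cases hU : A.symm (graphMap f a) ∈ U
  · have hn := hc.isUnitOutwardNormal hU (by simp) (by simpa using ha)
    rw [hF]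
    simp only [hn.outwardNormal_eq, AffineIsometryEquiv.apply_symm_apply, graphMap_zero]
    rw [← LinearIsometryEquiv.inner_map_map A.linearIsometryEquiv,
      LinearIsometryEquiv.apply_symm_apply, ← graphSpeed_mul_inner_graphNormal]
    ring
  · simp [hF0 _ hU, hG _ hU]

lemma finiteAtFilter (hc : IsGraphChart Ω U A f K) (hΩ : IsOpen Ω) {x : Plane} (hx : x ∈ U) :
    (Measure.hausdorffMeasure (1 : ℝ) : Measure Plane).FiniteAtFilter (𝓝[frontier Ω] x) := by
  refine ⟨frontier Ω ∩ (U ∩ Metric.ball x 1), inter_mem_nhdsWithin _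
    (inter_mem (hc.isOpen.mem_nhds hx) (Metric.ball_mem_nhds x one_pos)), ?_⟩
  have hsub : frontier Ω ∩ (U ∩ Metric.ball x 1)
      ⊆ A ⁻¹' (graphMap f '' Metric.closedBall (A x 0) 1) := by
    rintro y ⟨hyf, hyU, hyb⟩
    obtain ⟨a, ha⟩ := mem_range_graphMap_iff.2 ((hc.mem_frontier_iff hΩ hyU).1 hyf)
    refine ⟨a, ?_, ha⟩
    rw [← graphMap_zero f a, ha, Metric.mem_closedBall]
    have h1 : dist (A y 0) (A x 0) ≤ dist (A y) (A x) := by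
      rw [dist_eq_norm, dist_eq_norm]
      exact PiLp.norm_apply_le (A y - A x) 0
    rw [A.dist_map] at h1
    exact h1.trans (Metric.mem_ball.1 hyb).le
  refine (measure_mono hsub).trans_lt ?_
  rw [(measurePreserving_affineIsometry_hausdorffMeasure A).measure_preimage_emb
    (measurableEmbedding_affineIsometry A)]
  exact (hausdorffMeasure_graphMap_image_le hc.lipschitz _).trans_lt
    (ENNReal.mul_lt_top (by simp) measure_closedBall_lt_top)

/-- Interior cone condition: near `x`, the closure contains an open convex cone with vertex `x`.
This makes derivatives up to the boundary well determined. -/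
lemma uniqueDiffWithinAt (hc : IsGraphChart Ω U A f K) {x : Plane} (hx : x ∈ U)
    (hxf : A x 1 ≤ f (A x 0)) : UniqueDiffWithinAt ℝ (closure Ω) x := by
  -- The downward cone of slope `K`; as `f` is `K`-Lipschitz, the cone lies strictly below the
  -- graph.
  set D : Set Plane := {p | p 1 + K * |p 0 - A x 0| < A x 1} with hD
  have hDo : IsOpen D := isOpen_lt (by fun_prop) (by fun_prop)
  have hDc : Convex ℝ D := by
    intro p hp q hq s t hs ht hst
    simp only [hD, mem_ofPred_eq, PiLp.add_apply, PiLp.smul_apply, smul_eq_mul] at hp hq ⊢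
    have h1 : |s * p 0 + t * q 0 - A x 0| ≤ s * |p 0 - A x 0| + t * |q 0 - A x 0| := by
      have : s * p 0 + t * q 0 - A x 0 = s * (p 0 - A x 0) + t * (q 0 - A x 0) := by
        linear_combination (A x 0) * hst
      rw [this]
      refine (abs_add_le _ _).trans ?_
      rw [abs_mul, abs_mul, abs_of_nonneg hs, abs_of_nonneg ht]
    have h2 := mul_le_mul_of_nonneg_left h1 K.coe_nonneg
    have h3 : s * (p 1 + K * |p 0 - A x 0|) + t * (q 1 + K * |q 0 - A x 0|) < A x 1 :=
      convex_Iio (A x 1) hp hq hs ht hst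
    linarith
  set y : ℝ → Plane := fun s => A.symm (A x - s • EuclideanSpace.single 1 1) with hy
  have hyD : ∀ s, 0 < s → y s ∈ A ⁻¹' D := fun s hs => by
    simp only [hD, hy, mem_preimage, mem_ofPred_eq, AffineIsometryEquiv.apply_symm_apply]
    simpa using hs
  have hopen : IsOpen (A ⁻¹' D) := hDo.preimage A.continuous
  have hcl : x ∈ closure (A ⁻¹' D) := by
    have hcont : Continuous y := A.symm.continuous.comp (by fun_prop)
    have hlim : Tendsto y (𝓝[>] 0) (𝓝 x) := by
      have := (hcont.tendsto 0).mono_left (nhdsWithin_le_nhds (s := Ioi (0 : ℝ)))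
      simpa [hy] using this
    refine mem_closure_of_tendsto hlim ?_
    filter_upwards [self_mem_nhdsWithin] with s hs using hyD s hs
  have hconv : Convex ℝ (A ⁻¹' D) := hDc.affine_preimage A.toAffineEquiv.toAffineMap
  have h1 : UniqueDiffWithinAt ℝ (A ⁻¹' D) x := uniqueDiffWithinAt_convex hconv
    (by rw [hopen.interior_eq]; exact ⟨_, hyD 1 one_pos⟩) hcl
  refine (h1.inter (hc.isOpen.mem_nhds hx)).mono ?_
  rintro z ⟨hzD, hzU⟩
  refine subset_closure ((hc.mem_iff z hzU).2 ?_)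
  have h2 := hc.lipschitz.dist_le_mul (A x 0) (A z 0)
  rw [Real.dist_eq, Real.dist_eq, abs_sub_comm (A x 0)] at h2
  have h3 : A z 1 + K * |A z 0 - A x 0| < A x 1 := hzD
  linarith [le_abs_self (f (A x 0) - f (A z 0))]

end IsGraphChart

/-! ### From charts to the whole boundary -/

namespace IsBoundedLipschitzDomain

variable {Ω : Set Plane}

lemma hausdorffMeasure_frontier_lt_top (hΩ : IsBoundedLipschitzDomain Ω) :
    Measure.hausdorffMeasure (1 : ℝ) (frontier Ω) < ⊤ := by
  refine hΩ.isCompact_frontier.measure_lt_top_of_nhdsWithin fun x hx => ?_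
  obtain ⟨U, A, f, K, hxU, -, hc⟩ := hΩ.exists_chart hx
  exact hc.finiteAtFilter hΩ.isOpen hxU

lemma aestronglyMeasurable_outwardNormal (hΩ : IsBoundedLipschitzDomain Ω) :
    AEStronglyMeasurable (outwardNormal Ω)
      ((Measure.hausdorffMeasure (1 : ℝ)).restrict (frontier Ω)) := by
  choose! U A f K hxU _ hc using fun x (hx : x ∈ frontier Ω) => hΩ.exists_chart hx
  obtain ⟨t, htf, ht⟩ := hΩ.isCompact_frontier.elim_nhds_subcover U
    fun x hx => (hc x hx).isOpen.mem_nhds (hxU x hx)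
  have hset : frontier Ω = ⋃ x : t, frontier Ω ∩ U x := by
    rw [← inter_iUnion, eq_comm, inter_eq_left]
    simpa [iUnion_subtype] using ht
  rw [hset, aestronglyMeasurable_iUnion_iff]
  exact fun x => (hc x (htf x x.2)).aestronglyMeasurable_outwardNormal hΩ.isOpen

lemma ae_exists_isUnitOutwardNormal (hΩ : IsBoundedLipschitzDomain Ω) :
    ∀ᵐ x ∂(Measure.hausdorffMeasure (1 : ℝ)).restrict (frontier Ω),
      IsUnitOutwardNormal Ω x (outwardNormal Ω x) := by
  choose! U A f K hxU _ hc using fun x (hx : x ∈ frontier Ω) => hΩ.exists_chart hx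
  obtain ⟨t, htf, ht⟩ := hΩ.isCompact_frontier.elim_nhds_subcover U
    fun x hx => (hc x hx).isOpen.mem_nhds (hxU x hx)
  have hset : frontier Ω = ⋃ x : t, frontier Ω ∩ U x := by
    rw [← inter_iUnion, eq_comm, inter_eq_left]
    simpa [iUnion_subtype] using ht
  rw [hset, ae_restrict_iUnion_iff]
  intro x
  filter_upwards [(hc x (htf x x.2)).ae_isUnitOutwardNormal hΩ.isOpen] with y hy
  rwa [hy.outwardNormal_eq]

lemma uniqueDiffOn_closure (hΩ : IsBoundedLipschitzDomain Ω) : UniqueDiffOn ℝ (closure Ω) := by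
  intro x hx
  by_cases hxΩ : x ∈ Ω
  · exact (hΩ.isOpen.uniqueDiffWithinAt hxΩ).mono subset_closure
  · obtain ⟨U, A, f, K, hxU, -, hc⟩ := hΩ.exists_chart (x₀ := x)
      (by rw [hΩ.isOpen.frontier_eq]; exact ⟨hx, hxΩ⟩)
    exact hc.uniqueDiffWithinAt hxU ((hc.mem_closure_iff hxU).1 hx)

end IsBoundedLipschitzDomain

end ShallowWater

namespace ShallowWater

/-! ### The divergence theorem -/

section

variable {Ω : Set Plane} {w : Plane → ℝ}

lemma fderiv_eq_zero_of_notMem_tsupport {h : Plane → ℝ} {x : Plane} (hx : x ∉ tsupport h) :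
    fderiv ℝ h x = 0 := by
  by_contra h0
  exact hx (support_fderiv_subset ℝ h0)

lemma differentiableAt_of_contDiffOn_closure (hΩ : IsOpen Ω)
    (hw : ContDiffOn ℝ 1 w (closure Ω)) {x : Plane} (hx : x ∈ Ω) : DifferentiableAt ℝ w x :=
  (hw.differentiableOn one_ne_zero x (subset_closure hx)).differentiableAt
    (mem_of_superset (hΩ.mem_nhds hx) subset_closure)

lemma fderivWithin_closure_eq (hΩ : IsOpen Ω) {x : Plane} (hx : x ∈ Ω) :
    fderivWithin ℝ w (closure Ω) x = fderiv ℝ w x :=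
  fderivWithin_of_mem_nhds (mem_of_superset (hΩ.mem_nhds hx) subset_closure)

lemma IsBoundedLipschitzDomain.exists_bound_fderiv (hΩ : IsBoundedLipschitzDomain Ω)
    (hw : ContDiffOn ℝ 1 w (closure Ω)) : ∃ C, 0 ≤ C ∧ ∀ x ∈ Ω, ‖fderiv ℝ w x‖ ≤ C := by
  obtain ⟨C, hC⟩ := hΩ.isCompact_closure.exists_bound_of_continuousOn
    (hw.continuousOn_fderivWithin hΩ.uniqueDiffOn_closure le_rfl)
  refine ⟨|C|, abs_nonneg C, fun x hx => ?_⟩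
  rw [← fderivWithin_closure_eq hΩ.isOpen hx]
  exact (hC x (subset_closure hx)).trans (le_abs_self C)

lemma IsBoundedLipschitzDomain.integrableOn_fderiv (hΩ : IsBoundedLipschitzDomain Ω)
    (hw : ContDiffOn ℝ 1 w (closure Ω)) (e : Plane) :
    IntegrableOn (fun x => fderiv ℝ w x e) Ω := by
  obtain ⟨C, -, hC⟩ := hΩ.exists_bound_fderiv hw
  refine IntegrableOn.of_bound hΩ.isBounded.measure_lt_top
    (measurable_fderiv_apply_const ℝ w e).aestronglyMeasurable (C * ‖e‖) ?_
  refine ae_restrict_of_forall_mem hΩ.isOpen.measurableSet fun p hp => ?_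
  exact (ContinuousLinearMap.le_opNorm _ _).trans (by gcongr; exact hC p hp)

lemma IsBoundedLipschitzDomain.integrable_boundary (hΩ : IsBoundedLipschitzDomain Ω)
    (hw : ContinuousOn w (closure Ω)) (e : Plane) :
    IntegrableOn (fun x => w x * inner ℝ e (outwardNormal Ω x)) (frontier Ω)
      (Measure.hausdorffMeasure (1 : ℝ)) := by
  obtain ⟨C, hC⟩ := hΩ.isCompact_closure.exists_bound_of_continuousOn hw
  refine IntegrableOn.of_bound hΩ.hausdorffMeasure_frontier_lt_top ?_ (C * ‖e‖) ?_
  · exact ((hw.mono frontier_subset_closure).aestronglyMeasurable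
      isClosed_frontier.measurableSet).mul
      (aestronglyMeasurable_const.inner hΩ.aestronglyMeasurable_outwardNormal)
  · refine ae_restrict_of_forall_mem isClosed_frontier.measurableSet fun x hx => ?_
    have h1 := hC x (frontier_subset_closure hx)
    have h2 : ‖inner ℝ e (outwardNormal Ω x)‖ ≤ ‖e‖ :=
      (norm_inner_le_norm _ _).trans
        (mul_le_of_le_one_right (norm_nonneg _) (norm_outwardNormal_le Ω x))
    rw [norm_mul]
    exact mul_le_mul h1 h2 (norm_nonneg _) ((norm_nonneg _).trans h1)

/-- The support stays away from the boundary, so `w` is differentiable on the whole plane and can be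
integrated by parts against the constant 1. -/
lemma integral_fderiv_eq_zero_of_tsupport_subset (hΩ : IsBoundedLipschitzDomain Ω)
    (hw : ContDiffOn ℝ 1 w (closure Ω)) (hχ : tsupport w ⊆ Ω) (e : Plane) :
    ∫ x in Ω, fderiv ℝ w x e = 0 := by
  have hd : Differentiable ℝ w := fun x => by
    by_cases hx : x ∈ tsupport w
    · exact differentiableAt_of_contDiffOn_closure hΩ.isOpen hw (hχ hx)
    · exact (differentiableAt_const 0).congr_of_eventuallyEq
        (notMem_tsupport_iff_eventuallyEq.1 hx)
  have hcs : HasCompactSupport w :=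
    HasCompactSupport.of_support_subset_isCompact hΩ.isCompact_closure
      ((subset_tsupport w).trans (hχ.trans subset_closure))
  have hz : ∀ x ∉ Ω, fderiv ℝ w x e = 0 := fun x hx => by
    simp [fderiv_eq_zero_of_notMem_tsupport fun h => hx (hχ h)]
  have hi : Integrable (fun x => fderiv ℝ w x e) :=
    (hΩ.integrableOn_fderiv hw e).integrable_of_forall_notMem_eq_zero hz
  rw [setIntegral_eq_integral_of_forall_compl_eq_zero hz]
  have h := integral_mul_fderiv_eq_neg_fderiv_mul_of_integrable (μ := volume)
    (f := fun _ : Plane => (1 : ℝ)) (g := w) (v := e) (by simp) (by simpa using hi)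
    (by simpa using hd.continuous.integrable_of_hasCompactSupport hcs)
    (fun x _ => differentiableAt_const 1) fun x _ => hd x
  simpa using h

/-- Both sides are transported by the isometry `A` to the subgraph of `f`. Off `U` everything
vanishes, so it does not matter that `Ω` differs from the subgraph there. -/
lemma IsGraphChart.integral_fderiv {U : Set Plane} {A : Plane ≃ᵃⁱ[ℝ] Plane} {f : ℝ → ℝ} {K : ℝ≥0}
    (hc : IsGraphChart Ω U A f K) (hΩ : IsBoundedLipschitzDomain Ω)
    (hw : ContDiffOn ℝ 1 w (closure Ω)) (hcs : HasCompactSupport w) (hwU : tsupport w ⊆ U)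
    (e : Plane) :
    ∫ x in Ω, fderiv ℝ w x e
      = ∫ x in frontier Ω, w x * inner ℝ e (outwardNormal Ω x)
          ∂(Measure.hausdorffMeasure (1 : ℝ)) := by
  have hz : ∀ x ∉ U, w x = 0 := fun x hx => image_eq_zero_of_notMem_tsupport fun h => hx (hwU h)
  have hz' : ∀ x ∉ U, fderiv ℝ w x = 0 := fun x hx =>
    fderiv_eq_zero_of_notMem_tsupport fun h => hx (hwU h)
  have hfd : ∀ p, fderiv ℝ (fun q => w (A.symm q)) p
      = (fderiv ℝ w (A.symm p)).comp
          (A.linearIsometryEquiv.symm.toContinuousLinearEquiv : Plane →L[ℝ] Plane) := fun p => by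
    have := (ContinuousLinearEquiv.comp_right_fderiv
      A.linearIsometryEquiv.symm.toContinuousLinearEquiv (f := fun q => w (q + A.symm 0)) (x := p))
    rw [fderiv_comp_add_right] at this
    have hA : ∀ q, A.symm q = A.linearIsometryEquiv.symm q + A.symm 0 := fun q => by
      have := affineIsometry_sub A.symm q 0
      rw [sub_zero, sub_eq_iff_eq_add] at this
      exact this
    have h2 : (fun q => w (A.symm q)) = (fun q => w (q + A.symm 0)) ∘
        A.linearIsometryEquiv.symm.toContinuousLinearEquiv := by
      funext q; simp [hA q]
    rw [h2, this]
    simp [hA p]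
  obtain ⟨C, hC0, hC⟩ := hΩ.exists_bound_fderiv hw
  have hmem : ∀ p : Plane, p 1 < f (p 0) → A.symm p ∈ U → A.symm p ∈ Ω := fun p hp hU => by
    rw [hc.mem_iff _ hU]; simpa using hp
  have hL := integral_subgraph_fderiv hc.lipschitz (h := fun q => w (A.symm q)) (C := C)
    (hcs.comp_homeomorph A.symm.toHomeomorph) ?_ ?_ ?_ (A.linearIsometryEquiv e)
  · rw [hc.integral_frontier hΩ.isOpen hz e, ← hL]
    have hAΩ : Ω ∩ U = A ⁻¹' {p : Plane | p 1 < f (p 0)} ∩ U := by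
      ext x
      simp only [mem_inter_iff, mem_preimage, mem_ofPred_eq, and_congr_left_iff]
      exact hc.mem_iff x
    have hSm : MeasurableSet (A ⁻¹' {p : Plane | p 1 < f (p 0)}) :=
      ((isOpen_subgraph hc.lipschitz.continuous).preimage A.continuous).measurableSet
    have h2 := (measurePreserving_affineIsometry A).setIntegral_preimage_emb
      (measurableEmbedding_affineIsometry A)
      (fun p => fderiv ℝ (fun q => w (A.symm q)) p (A.linearIsometryEquiv e))
      {p : Plane | p 1 < f (p 0)}
    rw [← h2]
    simp only [hfd, AffineIsometryEquiv.symm_apply_apply, ContinuousLinearMap.comp_apply]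
    have he : (A.linearIsometryEquiv.symm.toContinuousLinearEquiv : Plane →L[ℝ] Plane)
        (A.linearIsometryEquiv e) = e := by simp
    rw [he, setIntegral_eq_of_subset_of_forall_sdiff_eq_zero hΩ.isOpen.measurableSet
      (inter_subset_left (s := Ω) (t := U))
      fun x hx => by simp [hz' x fun hU => hx.2 ⟨hx.1, hU⟩], hAΩ,
      ← setIntegral_eq_of_subset_of_forall_sdiff_eq_zero hSm
      (inter_subset_left (t := U)) fun x hx => by simp [hz' x fun hU => hx.2 ⟨hx.1, hU⟩]]
  · intro p hp
    by_cases hU : A.symm p ∈ U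
    · have h1 : A.symm p ∈ closure Ω := by rw [hc.mem_closure_iff hU]; simpa using hp
      have hn : A.symm ⁻¹' U ∈ 𝓝 p :=
        A.symm.continuous.continuousAt.preimage_mem_nhds (hc.isOpen.mem_nhds hU)
      rw [← continuousWithinAt_inter hn]
      refine (hw.continuousOn _ h1).comp A.symm.continuous.continuousWithinAt ?_
      rintro q ⟨hq, hqU⟩
      rw [hc.mem_closure_iff hqU]; simpa using hq
    · have h1 : A.symm p ∉ tsupport w := fun h => hU (hwU h)
      refine ContinuousAt.continuousWithinAt ?_
      have h2 : (fun q => w (A.symm q)) =ᶠ[𝓝 p] fun _ => 0 :=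
        A.symm.continuous.continuousAt.eventually (notMem_tsupport_iff_eventuallyEq.1 h1)
      exact continuousAt_const.congr h2.symm
  · intro p hp
    have hA : DifferentiableAt ℝ (fun q => A.symm q) p :=
      A.symm.toContinuousAffineEquiv.toContinuousAffineMap.differentiableAt
    refine DifferentiableAt.comp p (g := w) ?_ hA
    by_cases hU : A.symm p ∈ U
    · exact differentiableAt_of_contDiffOn_closure hΩ.isOpen hw (hmem p hp hU)
    · exact (differentiableAt_const 0).congr_of_eventuallyEq
        (notMem_tsupport_iff_eventuallyEq.1 fun h => hU (hwU h))
  · intro p hp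
    rw [hfd]
    have h1 : ‖fderiv ℝ w (A.symm p)‖ ≤ C := by
      by_cases hU : A.symm p ∈ U
      · exact hC _ (hmem p hp hU)
      · simpa [hz' _ hU] using hC0
    refine ContinuousLinearMap.opNorm_le_bound _ hC0 fun v => ?_
    rw [ContinuousLinearMap.comp_apply]
    refine (ContinuousLinearMap.le_opNorm _ _).trans ?_
    have : ‖(A.linearIsometryEquiv.symm.toContinuousLinearEquiv : Plane →L[ℝ] Plane) v‖ = ‖v‖ :=
      A.linearIsometryEquiv.symm.norm_map v
    rw [this]
    gcongr

open scoped Manifold ContDiff in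
/-- **Gauss–Green formula** on a bounded Lipschitz domain of the plane. -/
theorem IsBoundedLipschitzDomain.integral_fderiv (hΩ : IsBoundedLipschitzDomain Ω)
    (hw : ContDiffOn ℝ 1 w (closure Ω)) (e : Plane) :
    ∫ x in Ω, fderiv ℝ w x e
      = ∫ x in frontier Ω, w x * inner ℝ e (outwardNormal Ω x)
          ∂(Measure.hausdorffMeasure (1 : ℝ)) := by
  -- The formula is linear in `w`, so it suffices to have it for functions supported near one point:
  -- `Ω` itself serves for interior points, a chart for boundary points.
  have hlocal : ∀ x ∈ closure Ω, ∃ U : Set Plane, IsOpen U ∧ x ∈ U ∧ Bornology.IsBounded U ∧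
      ∀ v : Plane → ℝ, ContDiffOn ℝ 1 v (closure Ω) → HasCompactSupport v → tsupport v ⊆ U →
        ∫ x in Ω, fderiv ℝ v x e
          = ∫ x in frontier Ω, v x * inner ℝ e (outwardNormal Ω x)
            ∂(Measure.hausdorffMeasure (1 : ℝ)) := by
    intro x hx
    by_cases hxΩ : x ∈ Ω
    · refine ⟨Ω, hΩ.isOpen, hxΩ, hΩ.isBounded, fun v hv _ hvΩ => ?_⟩
      rw [integral_fderiv_eq_zero_of_tsupport_subset hΩ hv hvΩ e]
      refine (setIntegral_eq_zero_of_forall_eq_zero fun y hy => ?_).symm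
      rw [image_eq_zero_of_notMem_tsupport (f := v) fun h => ?_, zero_mul]
      rw [hΩ.isOpen.frontier_eq] at hy
      exact hy.2 (hvΩ h)
    · obtain ⟨U, A, f, K, hxU, hUb, hc⟩ := hΩ.exists_chart (x₀ := x)
        (by rw [hΩ.isOpen.frontier_eq]; exact ⟨hx, hxΩ⟩)
      exact ⟨U, hc.isOpen, hxU, Metric.isBounded_ball.subset hUb,
        fun v hv hcs hvU => hc.integral_fderiv hΩ hv hcs hvU e⟩
  choose! U hUo hxU hUb hU using hlocal
  obtain ⟨t, htc, ht⟩ := hΩ.isCompact_closure.elim_nhds_subcover U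
    fun x hx => (hUo x hx).mem_nhds (hxU x hx)
  obtain ⟨χ, hχ⟩ := SmoothPartitionOfUnity.exists_isSubordinate 𝓘(ℝ, Plane) isClosed_closure
    (fun i : t => U i) (fun i => hUo i (htc i i.2)) (by simpa [iUnion_subtype] using ht)
  have hχd : ∀ i, ContDiff ℝ 1 (χ i) := fun i =>
    (χ i).contMDiff.contDiff.of_le (by exact_mod_cast le_top)
  set v : t → Plane → ℝ := fun i x => χ i x * w x with hv
  have hvd : ∀ i, ContDiffOn ℝ 1 (v i) (closure Ω) := fun i => (hχd i).contDiffOn.mul hw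
  have hvsupp : ∀ i, tsupport (v i) ⊆ tsupport (χ i) := fun i => tsupport_mul_subset_left
  have hcs : ∀ i, HasCompactSupport (v i) := fun i =>
    ((hUb i (htc i i.2)).subset ((hvsupp i).trans (hχ i))).isCompact_closure.of_isClosed_subset
      (isClosed_tsupport _) subset_closure
  have hsum : ∀ x ∈ closure Ω, ∑ i, v i x = w x := fun x hx => by
    have := χ.sum_eq_one hx
    rw [finsum_eq_sum_of_fintype] at this
    rw [hv, ← Finset.sum_mul, this, one_mul]
  have hleft : ∫ x in Ω, fderiv ℝ w x e = ∫ x in Ω, ∑ i, fderiv ℝ (v i) x e := by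
    refine setIntegral_congr_fun hΩ.isOpen.measurableSet fun x hx => ?_
    have h1 : w =ᶠ[𝓝 x] fun y => ∑ i, v i y := by
      filter_upwards [hΩ.isOpen.mem_nhds hx] with y hy using (hsum y (subset_closure hy)).symm
    simp only [h1.fderiv_eq]
    rw [fderiv_fun_sum fun i _ => differentiableAt_of_contDiffOn_closure hΩ.isOpen (hvd i) hx]
    simp
  have hright : ∫ x in frontier Ω, w x * inner ℝ e (outwardNormal Ω x)
        ∂(Measure.hausdorffMeasure (1 : ℝ))
      = ∫ x in frontier Ω, ∑ i, v i x * inner ℝ e (outwardNormal Ω x)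
        ∂(Measure.hausdorffMeasure (1 : ℝ)) := by
    refine setIntegral_congr_fun isClosed_frontier.measurableSet fun x hx => ?_
    simp only [← Finset.sum_mul, hsum x (frontier_subset_closure hx)]
  rw [hleft, hright, integral_finsetSum _ fun i _ => hΩ.integrableOn_fderiv (hvd i) e,
    integral_finsetSum _ fun i _ => hΩ.integrable_boundary (hvd i).continuousOn e]
  exact Finset.sum_congr rfl fun i _ =>
    hU i (htc i i.2) (v i) (hvd i) (hcs i) ((hvsupp i).trans (hχ i))

lemma IsBoundedLipschitzDomain.integrableOn_divergence (hΩ : IsBoundedLipschitzDomain Ω)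
    {W : Plane → Plane} (hW : ContDiffOn ℝ 1 W (closure Ω)) :
    IntegrableOn (divergence Ω W) Ω := by
  have hWi : ∀ i, ContDiffOn ℝ 1 (fun x => W x i) (closure Ω) := contDiffOn_piLp 2 |>.1 hW
  refine IntegrableOn.congr_fun (f := fun x =>
    ∑ i, fderiv ℝ (fun y => W y i) x (EuclideanSpace.single i 1))
    (integrable_finsetSum _ fun i _ => hΩ.integrableOn_fderiv (hWi i) _) (fun x hx => ?_)
    hΩ.isOpen.measurableSet
  simp only [divergence, partialDeriv, fderivWithin_closure_eq hΩ.isOpen hx]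

/-- **Divergence theorem** on a bounded Lipschitz domain of the plane. -/
theorem IsBoundedLipschitzDomain.integral_divergence (hΩ : IsBoundedLipschitzDomain Ω)
    {W : Plane → Plane} (hW : ContDiffOn ℝ 1 W (closure Ω)) :
    ∫ x in Ω, divergence Ω W x
      = ∫ x in frontier Ω, inner ℝ (W x) (outwardNormal Ω x)
          ∂(Measure.hausdorffMeasure (1 : ℝ)) := by
  have hWi : ∀ i, ContDiffOn ℝ 1 (fun x => W x i) (closure Ω) := contDiffOn_piLp 2 |>.1 hW
  have hleft : ∫ x in Ω, divergence Ω W x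
      = ∫ x in Ω, ∑ i, fderiv ℝ (fun y => W y i) x (EuclideanSpace.single i 1) := by
    refine setIntegral_congr_fun hΩ.isOpen.measurableSet fun x hx => ?_
    simp only [divergence, partialDeriv, fderivWithin_closure_eq hΩ.isOpen hx]
  have hright : ∀ x, inner ℝ (W x) (outwardNormal Ω x)
      = ∑ i, W x i * inner ℝ (EuclideanSpace.single i 1) (outwardNormal Ω x) := fun x => by
    simp [PiLp.inner_apply, Fin.sum_univ_two, mul_comm]
  simp only [hright]
  rw [hleft, integral_finsetSum _ fun i _ => hΩ.integrableOn_fderiv (hWi i) _,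
    integral_finsetSum _ fun i _ => hΩ.integrable_boundary (hWi i).continuousOn _]
  exact Finset.sum_congr rfl fun i _ => hΩ.integral_fderiv (hWi i) _

end

end ShallowWater

namespace ShallowWater

/-! ### The local energy balance -/

section

variable {Ω : Set Plane} {x : Plane} {a b : Plane → ℝ}

lemma partialDeriv_mul (hU : UniqueDiffWithinAt ℝ (closure Ω) x)
    (ha : DifferentiableWithinAt ℝ a (closure Ω) x)
    (hb : DifferentiableWithinAt ℝ b (closure Ω) x) (i : Fin 2) :
    partialDeriv Ω i (fun y => a y * b y) x
      = a x * partialDeriv Ω i b x + b x * partialDeriv Ω i a x := by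
  simp [partialDeriv, fderivWithin_fun_mul hU ha hb]

lemma partialDeriv_add (hU : UniqueDiffWithinAt ℝ (closure Ω) x)
    (ha : DifferentiableWithinAt ℝ a (closure Ω) x)
    (hb : DifferentiableWithinAt ℝ b (closure Ω) x) (i : Fin 2) :
    partialDeriv Ω i (fun y => a y + b y) x = partialDeriv Ω i a x + partialDeriv Ω i b x := by
  simp [partialDeriv, fderivWithin_fun_add hU ha hb]

lemma partialDeriv_const_mul (hU : UniqueDiffWithinAt ℝ (closure Ω) x)
    (ha : DifferentiableWithinAt ℝ a (closure Ω) x) (r : ℝ) (i : Fin 2) :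
    partialDeriv Ω i (fun y => r * a y) x = r * partialDeriv Ω i a x := by
  simp [partialDeriv, (ha.hasFDerivWithinAt.const_mul r).fderivWithin hU]

lemma strainRate_symm (Ω : Set Plane) (v : Plane → Plane) (x : Plane) (i j : Fin 2) :
    strainRate Ω v x i j = strainRate Ω v x j i := by
  simp [strainRate, add_comm]

lemma norm_sq_plane (p : Plane) : ‖p‖ ^ 2 = p 0 * p 0 + p 1 * p 1 := by
  rw [EuclideanSpace.norm_sq_eq]
  simp [Fin.sum_univ_two, sq]

/-- The energy flux of a flow with depth `p`, elevation `q` and velocity `v`. -/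
noncomputable def energyFlux (Ω : Set Plane) (ρ μ g : ℝ) (p q : Plane → ℝ) (v : Plane → Plane)
    (x : Plane) : Plane :=
  (2 * μ) • (p x • applyMatrix (strainRate Ω v x) (v x))
    - ((ρ / 2) • ((p x * ‖v x‖ ^ 2) • v x) + (ρ * g) • ((p x * q x) • v x))

/-- The form to which `partialDeriv_flux` applies. The products `p D` and `p v` are kept whole
because the equations contain derivatives of exactly these. -/
lemma energyFlux_apply (Ω : Set Plane) (ρ μ g : ℝ) (p q : Plane → ℝ) (v : Plane → Plane)
    (x : Plane) (j : Fin 2) :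
    energyFlux Ω ρ μ g p q v x j
      = (2 * μ) * (p x * strainRate Ω v x 0 j * v x 0 + p x * strainRate Ω v x 1 j * v x 1)
        + (-1) * ((ρ / 2) * (p x * v x j * (v x 0 * v x 0 + v x 1 * v x 1))
          + (ρ * g) * (p x * v x j * q x)) := by
  simp only [energyFlux, applyMatrix, norm_sq_plane, PiLp.sub_apply, PiLp.add_apply,
    PiLp.smul_apply, smul_eq_mul, Matrix.mulVec, dotProduct, Fin.sum_univ_two,
    strainRate_symm Ω v x j]
  ring

lemma partialDeriv_flux {P₀ P₁ m v₀ v₁ q : Plane → ℝ} {c r s : ℝ} {i : Fin 2}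
    (hU : UniqueDiffWithinAt ℝ (closure Ω) x)
    (hP₀ : DifferentiableWithinAt ℝ P₀ (closure Ω) x)
    (hP₁ : DifferentiableWithinAt ℝ P₁ (closure Ω) x)
    (hm : DifferentiableWithinAt ℝ m (closure Ω) x)
    (hv₀ : DifferentiableWithinAt ℝ v₀ (closure Ω) x)
    (hv₁ : DifferentiableWithinAt ℝ v₁ (closure Ω) x)
    (hq : DifferentiableWithinAt ℝ q (closure Ω) x) :
    partialDeriv Ω i (fun y => c * (P₀ y * v₀ y + P₁ y * v₁ y)
        + (-1) * (r * (m y * (v₀ y * v₀ y + v₁ y * v₁ y)) + s * (m y * q y))) x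
      = c * (P₀ x * partialDeriv Ω i v₀ x + v₀ x * partialDeriv Ω i P₀ x
          + P₁ x * partialDeriv Ω i v₁ x + v₁ x * partialDeriv Ω i P₁ x)
        - (r * (m x * (2 * v₀ x * partialDeriv Ω i v₀ x + 2 * v₁ x * partialDeriv Ω i v₁ x)
            + (v₀ x * v₀ x + v₁ x * v₁ x) * partialDeriv Ω i m x)
          + s * (m x * partialDeriv Ω i q x + q x * partialDeriv Ω i m x)) := by
  rw [partialDeriv_add hU (by fun_prop) (by fun_prop), partialDeriv_const_mul hU (by fun_prop),
    partialDeriv_add hU (by fun_prop) (by fun_prop), partialDeriv_mul hU hP₀ hv₀,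
    partialDeriv_mul hU hP₁ hv₁, partialDeriv_const_mul hU (by fun_prop),
    partialDeriv_add hU (by fun_prop) (by fun_prop), partialDeriv_const_mul hU (by fun_prop),
    partialDeriv_mul hU hm (by fun_prop), partialDeriv_add hU (by fun_prop) (by fun_prop),
    partialDeriv_mul hU hv₀ hv₀, partialDeriv_mul hU hv₁ hv₁,
    partialDeriv_const_mul hU (by fun_prop), partialDeriv_mul hU hm hq]
  ring

/-- The local energy balance: mass conservation and momentum balance, multiplied by the right
factors, add up to a divergence and a dissipation term. -/
lemma energy_balance_pointwise {ρ μ g pt : ℝ} {p q : Plane → ℝ} {v : Plane → Plane}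
    {vt : Fin 2 → ℝ}
    (hU : UniqueDiffWithinAt ℝ (closure Ω) x)
    (hp : DifferentiableWithinAt ℝ p (closure Ω) x)
    (hq : DifferentiableWithinAt ℝ q (closure Ω) x)
    (hv : ∀ i, DifferentiableWithinAt ℝ (fun y => v y i) (closure Ω) x)
    (hD : ∀ i j, DifferentiableWithinAt ℝ (fun y => strainRate Ω v y i j) (closure Ω) x)
    (mass : pt + divergence Ω (fun y => p y • v y) x = 0)
    (momentum : ∀ i : Fin 2,
      ρ * p x * (vt i + ∑ j, v x j * partialDeriv Ω j (fun y => v y i) x)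
        - 2 * μ * ∑ j, partialDeriv Ω j (fun y => p y * strainRate Ω v y i j) x
        + ρ * g * p x * partialDeriv Ω i q x = 0) :
    ρ / 2 * (pt * ‖v x‖ ^ 2 + p x * (2 * ∑ i, v x i * vt i)) + ρ * g * q x * pt
      = divergence Ω (energyFlux Ω ρ μ g p q v) x
        + -(2 * μ) * (p x * frobeniusSq (strainRate Ω v x)) := by
  have m0 := momentum 0
  have m1 := momentum 1
  have h00 : strainRate Ω v x 0 0 = partialDeriv Ω 0 (fun y => v y 0) x := by
    simp [strainRate]
  have h11 : strainRate Ω v x 1 1 = partialDeriv Ω 1 (fun y => v y 1) x := by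
    simp [strainRate]
  have h01 : strainRate Ω v x 0 1
      = (partialDeriv Ω 1 (fun y => v y 0) x + partialDeriv Ω 0 (fun y => v y 1) x) / 2 := by
    simp [strainRate]
  have hs : ∀ y, strainRate Ω v y 1 0 = strainRate Ω v y 0 1 := fun y => strainRate_symm Ω v y 1 0
  have hv0 := hv 0
  have hv1 := hv 1
  have hD00 := hD 0 0
  have hD01 := hD 0 1
  have hD11 := hD 1 1
  simp only [divergence, Fin.sum_univ_two, PiLp.smul_apply, smul_eq_mul] at mass m0 m1
  simp only [divergence, energyFlux_apply, Fin.sum_univ_two, frobeniusSq, norm_sq_plane, hs]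
  simp only [hs] at m1
  rw [partialDeriv_flux hU (hp.fun_mul hD00) (hp.fun_mul hD01) (hp.fun_mul hv0) hv0 hv1 hq,
    partialDeriv_flux hU (hp.fun_mul hD01) (hp.fun_mul hD11) (hp.fun_mul hv1) hv0 hv1 hq]
  -- The multipliers are the factors of the mass equation and the components of the velocity; the
  -- last group replaces `D : ∇v` by `D : D`.
  linear_combination (ρ / 2 * (v x 0 * v x 0 + v x 1 * v x 1) + ρ * g * q x) * mass
    + v x 0 * m0 + v x 1 * m1
    + 2 * μ * p x * (strainRate Ω v x 0 0 * h00 + 2 * strainRate Ω v x 0 1 * h01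
      + strainRate Ω v x 1 1 * h11)

lemma inner_applyMatrix_strainRate (Ω : Set Plane) (v : Plane → Plane) (x n w : Plane) :
    inner ℝ (applyMatrix (strainRate Ω v x) n) w
      = inner ℝ (applyMatrix (strainRate Ω v x) w) n := by
  simp only [applyMatrix, PiLp.inner_apply, Fin.sum_univ_two, Matrix.mulVec, dotProduct,
    strainRate_symm Ω v x 1 0]
  simp
  ring

lemma inner_energyFlux (Ω : Set Plane) (ρ μ g : ℝ) (p q : Plane → ℝ) (v : Plane → Plane)
    (x n : Plane) :
    inner ℝ (energyFlux Ω ρ μ g p q v x) n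
      = 2 * μ * (p x * inner ℝ (applyMatrix (strainRate Ω v x) n) (v x))
        - (ρ / 2 * (p x * ‖v x‖ ^ 2 * inner ℝ (v x) n)
          + ρ * g * (p x * q x * inner ℝ (v x) n)) := by
  rw [inner_applyMatrix_strainRate]
  simp only [energyFlux, inner_sub_left, inner_add_left, real_inner_smul_left]

/-- In the plane, a vector parallel to a unit normal is orthogonal to every tangential vector. -/
lemma inner_eq_zero_of_cross_eq_zero {m n w : Plane} (hn : ‖n‖ = 1) (hc : cross m n = 0)
    (hw : inner ℝ w n = 0) : inner ℝ m w = 0 := by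
  have hn2 : n 0 * n 0 + n 1 * n 1 = 1 := by rw [← norm_sq_plane, hn]; norm_num
  simp only [cross] at hc
  simp only [PiLp.inner_apply, Fin.sum_univ_two, RCLike.inner_apply, conj_trivial] at hw ⊢
  linear_combination (-(w 0 * m 0 + w 1 * m 1)) * hn2 + (w 0 * n 1 - w 1 * n 0) * hc
    + (m 0 * n 0 + m 1 * n 1) * hw

end

end ShallowWater

namespace ShallowWater

/-! ### Functions on the space-time cylinder -/

section

variable {Ω : Set Plane} {T : ℝ}

lemma continuousOn_slice {X : Type*} [TopologicalSpace X] {F : Plane × ℝ → X}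
    (hF : ContinuousOn F (closure Ω ×ˢ Icc 0 T)) {t : ℝ} (ht : t ∈ Icc 0 T) :
    ContinuousOn (fun y => F (y, t)) (closure Ω) :=
  hF.comp (continuous_id.prodMk continuous_const).continuousOn fun _ hy => ⟨hy, ht⟩

lemma continuousOn_time_slice {X : Type*} [TopologicalSpace X] {F : Plane × ℝ → X}
    (hF : ContinuousOn F (closure Ω ×ˢ Icc 0 T)) {x : Plane} (hx : x ∈ closure Ω) :
    ContinuousOn (fun t => F (x, t)) (Icc 0 T) :=
  hF.comp (continuous_const.prodMk continuous_id).continuousOn fun _ ht => ⟨hx, ht⟩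

variable {E : Type*} [NormedAddCommGroup E] [NormedSpace ℝ E]

lemma IsBoundedLipschitzDomain.uniqueDiffOn_cylinder (hΩ : IsBoundedLipschitzDomain Ω)
    (hT : 0 < T) : UniqueDiffOn ℝ (closure Ω ×ˢ Icc 0 T) :=
  hΩ.uniqueDiffOn_closure.prod (uniqueDiffOn_Icc hT)

lemma IsBoundedLipschitzDomain.isCompact_cylinder (hΩ : IsBoundedLipschitzDomain Ω) (T : ℝ) :
    IsCompact (closure Ω ×ˢ Icc 0 T) :=
  hΩ.isCompact_closure.prod isCompact_Icc

lemma cylinder_mem_nhds (hΩ : IsOpen Ω) {x : Plane} {t : ℝ} (hx : x ∈ Ω) (ht : t ∈ Ioo 0 T) :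
    closure Ω ×ˢ Icc 0 T ∈ 𝓝 (x, t) :=
  prod_mem_nhds (mem_of_superset (hΩ.mem_nhds hx) subset_closure) (Icc_mem_nhds ht.1 ht.2)

lemma contDiffOn_slice {n : WithTop ℕ∞} {F : Plane × ℝ → E}
    (hF : ContDiffOn ℝ n F (closure Ω ×ˢ Icc 0 T)) {t : ℝ} (ht : t ∈ Icc 0 T) :
    ContDiffOn ℝ n (fun y => F (y, t)) (closure Ω) :=
  hF.comp (contDiff_id.prodMk contDiff_const).contDiffOn fun _ hy => ⟨hy, ht⟩

lemma hasDerivAt_time_slice (hΩ : IsOpen Ω) {F : Plane × ℝ → E}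
    (hF : ContDiffOn ℝ 1 F (closure Ω ×ˢ Icc 0 T)) {x : Plane} {t : ℝ} (hx : x ∈ Ω)
    (ht : t ∈ Ioo 0 T) :
    HasDerivAt (fun s => F (x, s)) (fderivWithin ℝ F (closure Ω ×ˢ Icc 0 T) (x, t) (0, 1)) t := by
  have hn := cylinder_mem_nhds hΩ hx ht
  have h1 : HasFDerivAt F (fderivWithin ℝ F (closure Ω ×ˢ Icc 0 T) (x, t)) (x, t) :=
    ((hF.differentiableOn one_ne_zero) _ (mem_of_mem_nhds hn)).hasFDerivWithinAt.hasFDerivAt hn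
  exact h1.comp_hasDerivAt t ((hasDerivAt_const t x).prodMk (hasDerivAt_id t))

/-- Expresses a spatial derivative at fixed time through the derivative on the cylinder, from which
it inherits regularity jointly in space and time. -/
lemma partialDeriv_slice (hΩ : IsBoundedLipschitzDomain Ω) {F : Plane × ℝ → ℝ}
    {x : Plane} {t : ℝ} (hF : DifferentiableWithinAt ℝ F (closure Ω ×ˢ Icc 0 T) (x, t))
    (hx : x ∈ closure Ω) (ht : t ∈ Icc 0 T) (j : Fin 2) :
    partialDeriv Ω j (fun y => F (y, t)) x
      = fderivWithin ℝ F (closure Ω ×ˢ Icc 0 T) (x, t) (EuclideanSpace.single j 1, 0) := by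
  have hmaps : MapsTo (fun y => (y, t)) (closure Ω) (closure Ω ×ˢ Icc 0 T) :=
    fun y hy => ⟨hy, ht⟩
  have h1 : HasFDerivWithinAt (fun y => F (y, t)) _ (closure Ω) x :=
    hF.hasFDerivWithinAt.comp x (hasFDerivAt_prodMk_left x t).hasFDerivWithinAt hmaps
  rw [partialDeriv, h1.fderivWithin (hΩ.uniqueDiffOn_closure x hx)]
  rfl

lemma contDiffOn_strainRate (hΩ : IsBoundedLipschitzDomain Ω) (hT : 0 < T)
    {u : Plane → ℝ → Plane}
    (hu : ContDiffOn ℝ 2 (fun p : Plane × ℝ => u p.1 p.2) (closure Ω ×ˢ Icc 0 T)) (i j : Fin 2) :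
    ContDiffOn ℝ 1 (fun p : Plane × ℝ => strainRate Ω (fun y => u y p.2) p.1 i j)
      (closure Ω ×ˢ Icc 0 T) := by
  have hui : ∀ i, ContDiffOn ℝ 2 (fun p : Plane × ℝ => u p.1 p.2 i) (closure Ω ×ˢ Icc 0 T) :=
    contDiffOn_piLp 2 |>.1 hu
  have hpd : ∀ i j, ContDiffOn ℝ 1
      (fun p : Plane × ℝ => partialDeriv Ω j (fun y => u y p.2 i) p.1)
      (closure Ω ×ˢ Icc 0 T) := fun i j => by
    have h1 := ((hui i).fderivWithin (m := 1) (hΩ.uniqueDiffOn_cylinder hT) (by norm_num)).clm_apply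
      (contDiffOn_const (c := ((EuclideanSpace.single j 1, 0) : Plane × ℝ)))
    refine h1.congr fun p hp => ?_
    exact partialDeriv_slice hΩ (F := fun p : Plane × ℝ => u p.1 p.2 i)
      ((hui i).differentiableOn two_ne_zero p hp) hp.1 hp.2 j
  exact ((hpd i j).add (hpd j i)).div_const 2

lemma contDiffOn_energyFlux (hΩ : IsBoundedLipschitzDomain Ω) (hT : 0 < T) {ρ μ g : ℝ}
    {φ η : Plane → ℝ → ℝ} {u : Plane → ℝ → Plane}
    (hφ : ContDiffOn ℝ 1 (fun p : Plane × ℝ => φ p.1 p.2) (closure Ω ×ˢ Icc 0 T))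
    (hη : ContDiffOn ℝ 1 (fun p : Plane × ℝ => η p.1 p.2) (closure Ω ×ˢ Icc 0 T))
    (hu : ContDiffOn ℝ 2 (fun p : Plane × ℝ => u p.1 p.2) (closure Ω ×ˢ Icc 0 T)) :
    ContDiffOn ℝ 1 (fun p : Plane × ℝ => energyFlux Ω ρ μ g (fun y => φ y p.2) (fun y => η y p.2)
      (fun y => u y p.2) p.1) (closure Ω ×ˢ Icc 0 T) := by
  have hui : ∀ i, ContDiffOn ℝ 1 (fun p : Plane × ℝ => u p.1 p.2 i) (closure Ω ×ˢ Icc 0 T) :=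
    contDiffOn_piLp 2 |>.1 (hu.of_le (by norm_num))
  have hD := contDiffOn_strainRate hΩ hT hu
  refine (contDiffOn_piLp 2).2 fun j => ?_
  simp only [energyFlux_apply]
  have h0 := hui 0
  have h1 := hui 1
  have hj := hui j
  have hD0 := hD 0 j
  have hD1 := hD 1 j
  fun_prop

lemma continuousOn_frobeniusSq_strainRate (hΩ : IsBoundedLipschitzDomain Ω) (hT : 0 < T)
    {u : Plane → ℝ → Plane}
    (hu : ContDiffOn ℝ 2 (fun p : Plane × ℝ => u p.1 p.2) (closure Ω ×ˢ Icc 0 T)) :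
    ContinuousOn (fun p : Plane × ℝ => frobeniusSq (strainRate Ω (fun y => u y p.2) p.1))
      (closure Ω ×ˢ Icc 0 T) := by
  unfold frobeniusSq
  exact continuousOn_finsetSum _ fun i _ => continuousOn_finsetSum _ fun j _ =>
    (contDiffOn_strainRate hΩ hT hu i j).continuousOn.pow 2

/-- Dominated convergence on a compact cylinder. The generality covers boundary fluxes (`m` the
normal, `κ` the length) and volume integrals (`m = 1`) alike. -/
lemma continuousOn_integral_inner (hΩ : IsBoundedLipschitzDomain Ω)
    {E : Type*} [NormedAddCommGroup E] [InnerProductSpace ℝ E]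
    {V : Plane × ℝ → E} (hV : ContinuousOn V (closure Ω ×ˢ Icc 0 T)) {S : Set Plane}
    (hS : MeasurableSet S) (hSΩ : S ⊆ closure Ω) {κ : Measure Plane} (hκ : κ S < ⊤)
    {m : Plane → E} (hm : AEStronglyMeasurable m (κ.restrict S)) (hm1 : ∀ x, ‖m x‖ ≤ 1) :
    ContinuousOn (fun t => ∫ x in S, inner ℝ (V (x, t)) (m x) ∂κ) (Icc 0 T) := by
  obtain ⟨C, hC⟩ := (hΩ.isCompact_cylinder T).exists_bound_of_continuousOn hV
  have : IsFiniteMeasure (κ.restrict S) := ⟨by simpa using hκ⟩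
  refine continuousOn_of_dominated (bound := fun _ => C) (fun t ht => ?_) (fun t ht => ?_)
    (integrable_const C) ?_
  · exact ((continuousOn_slice hV ht).aestronglyMeasurable_of_subset_isCompact
      hΩ.isCompact_closure hS hSΩ).inner hm
  · refine ae_restrict_of_forall_mem hS fun x hx => ?_
    exact (norm_inner_le_norm _ _).trans ((mul_le_of_le_one_right (norm_nonneg _) (hm1 x)).trans
      (hC (x, t) ⟨hSΩ hx, ht⟩))
  · refine ae_restrict_of_forall_mem hS fun x hx => ?_
    exact (continuousOn_time_slice hV (hSΩ hx)).inner continuousOn_const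

lemma IsBoundedLipschitzDomain.integrableOn_of_continuousOn (hΩ : IsBoundedLipschitzDomain Ω)
    {a : Plane → ℝ} (ha : ContinuousOn a (closure Ω)) : IntegrableOn a Ω :=
  (ha.integrableOn_compact hΩ.isCompact_closure).mono_set subset_closure

lemma continuousOn_integral (hΩ : IsBoundedLipschitzDomain Ω) {F : Plane × ℝ → ℝ}
    (hF : ContinuousOn F (closure Ω ×ˢ Icc 0 T)) :
    ContinuousOn (fun t => ∫ x in Ω, F (x, t)) (Icc 0 T) := by
  have h := continuousOn_integral_inner hΩ hF hΩ.isOpen.measurableSet subset_closure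
    (κ := volume) hΩ.isBounded.measure_lt_top (m := fun _ => (1 : ℝ))
    aestronglyMeasurable_const (by simp)
  simpa using h

/-- The time derivative is continuous on the compact cylinder, so a constant dominates it on the
bounded set `Ω`. -/
lemma hasDerivAt_integral (hΩ : IsBoundedLipschitzDomain Ω) (hT : 0 < T) {F : Plane × ℝ → ℝ}
    (hF : ContDiffOn ℝ 1 F (closure Ω ×ˢ Icc 0 T)) {t : ℝ} (ht : t ∈ Ioo 0 T) :
    HasDerivAt (fun t => ∫ x in Ω, F (x, t)) (∫ x in Ω, deriv (fun s => F (x, s)) t) t := by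
  have hF' : ContinuousOn (fun p => fderivWithin ℝ F (closure Ω ×ˢ Icc 0 T) p (0, 1))
      (closure Ω ×ˢ Icc 0 T) :=
    (hF.continuousOn_fderivWithin (hΩ.uniqueDiffOn_cylinder hT) le_rfl).clm_apply
      continuousOn_const
  obtain ⟨C, hC⟩ := (hΩ.isCompact_cylinder T).exists_bound_of_continuousOn hF'
  have : IsFiniteMeasure (volume.restrict Ω) := ⟨by simpa using hΩ.isBounded.measure_lt_top⟩
  have h := (hasDerivAt_integral_of_dominated_loc_of_deriv_le (μ := volume.restrict Ω)
    (F := fun t x => F (x, t)) (x₀ := t) (s := Ioo 0 T) (bound := fun _ => C)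
    (F' := fun t x => fderivWithin ℝ F (closure Ω ×ˢ Icc 0 T) (x, t) (0, 1))
    (Ioo_mem_nhds ht.1 ht.2) ?_ ?_ ?_ ?_ (integrable_const C) ?_).2
  · refine h.congr_deriv (setIntegral_congr_fun hΩ.isOpen.measurableSet fun x hx => ?_)
    exact (hasDerivAt_time_slice hΩ.isOpen hF hx ht).deriv.symm
  · filter_upwards [Icc_mem_nhds ht.1 ht.2] with s hs
    exact (hΩ.integrableOn_of_continuousOn
      (continuousOn_slice hF.continuousOn hs)).aestronglyMeasurable
  · exact hΩ.integrableOn_of_continuousOn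
      (continuousOn_slice hF.continuousOn (Ioo_subset_Icc_self ht))
  · exact (hΩ.integrableOn_of_continuousOn
      (continuousOn_slice hF' (Ioo_subset_Icc_self ht))).aestronglyMeasurable
  · exact ae_restrict_of_forall_mem hΩ.isOpen.measurableSet fun x hx s hs =>
      hC (x, s) ⟨subset_closure hx, Ioo_subset_Icc_self hs⟩
  · exact ae_restrict_of_forall_mem hΩ.isOpen.measurableSet fun x hx s hs =>
      hasDerivAt_time_slice hΩ.isOpen hF hx hs

end

/-- A derivative in the interior of an interval that extends continuously to the end points is
also the one-sided derivative there. -/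
lemma hasDerivWithinAt_Icc_of_continuousOn {F F' : ℝ → ℝ} {a b : ℝ} (hab : a < b)
    (hF : ContinuousOn F (Icc a b)) (hF' : ContinuousOn F' (Icc a b))
    (h : ∀ t ∈ Ioo a b, HasDerivAt F (F' t) t) {t : ℝ} (ht : t ∈ Icc a b) :
    HasDerivWithinAt F (F' t) (Icc a b) t := by
  have hd : DifferentiableOn ℝ F (Ioo a b) := fun s hs =>
    (h s hs).differentiableAt.differentiableWithinAt
  have hlim : ∀ s ∈ Icc a b, Tendsto (deriv F) (𝓝[Ioo a b] s) (𝓝 (F' s)) := fun s hs =>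
    ((hF' s hs).mono Ioo_subset_Icc_self).tendsto.congr' (by
      filter_upwards [self_mem_nhdsWithin] with r hr using (h r hr).deriv.symm)
  rcases ht.1.eq_or_lt with rfl | h1
  · have h2 := hlim a ht
    rw [nhdsWithin_Ioo_eq_nhdsGT hab] at h2
    exact (hasDerivWithinAt_Ici_of_tendsto_deriv hd ((hF a ht).mono Ioo_subset_Icc_self)
      (Ioo_mem_nhdsGT hab) h2).mono Icc_subset_Ici_self
  · rcases ht.2.eq_or_lt with rfl | h3
    · have h2 := hlim t ht
      rw [nhdsWithin_Ioo_eq_nhdsLT hab] at h2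
      exact (hasDerivWithinAt_Iic_of_tendsto_deriv hd ((hF t ht).mono Ioo_subset_Icc_self)
        (Ioo_mem_nhdsLT hab) h2).mono Icc_subset_Iic_self
    · exact (h t ⟨h1, h3⟩).hasDerivWithinAt

end ShallowWater

namespace ShallowWater

/-! ### The global energy balance -/

section

variable {Ω ΓD ΓS ΓT : Set Plane} {T ρ μ g : ℝ} {ζ : Plane → ℝ} {φ : Plane → ℝ → ℝ}
  {u : Plane → ℝ → Plane}

lemma contDiffOn_elevation (hζ : ContDiffOn ℝ 1 ζ (closure Ω))
    (hφ : ContDiffOn ℝ 1 (fun p : Plane × ℝ => φ p.1 p.2) (closure Ω ×ˢ Icc 0 T)) :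
    ContDiffOn ℝ 1 (fun p : Plane × ℝ => elevation ζ φ p.1 p.2) (closure Ω ×ˢ Icc 0 T) :=
  hφ.sub (hζ.comp contDiff_fst.contDiffOn fun _ hp => hp.1)

/-- The density of the total energy. -/
noncomputable def energyDensity (ρ g : ℝ) (ζ : Plane → ℝ) (φ : Plane → ℝ → ℝ)
    (u : Plane → ℝ → Plane) (p : Plane × ℝ) : ℝ :=
  ρ / 2 * (φ p.1 p.2 * ‖u p.1 p.2‖ ^ 2) + ρ * g * (elevation ζ φ p.1 p.2 ^ 2 / 2)

lemma contDiffOn_energyDensity (hζ : ContDiffOn ℝ 1 ζ (closure Ω))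
    (hφ : ContDiffOn ℝ 1 (fun p : Plane × ℝ => φ p.1 p.2) (closure Ω ×ˢ Icc 0 T))
    (hu : ContDiffOn ℝ 2 (fun p : Plane × ℝ => u p.1 p.2) (closure Ω ×ˢ Icc 0 T)) :
    ContDiffOn ℝ 1 (energyDensity ρ g ζ φ u) (closure Ω ×ˢ Icc 0 T) :=
  (contDiffOn_const.mul (hφ.mul ((hu.of_le (by norm_num)).norm_sq ℝ))).add
    (contDiffOn_const.mul (((contDiffOn_elevation hζ hφ).pow 2).div_const 2))

lemma energy_eq_integral (hΩ : IsBoundedLipschitzDomain Ω)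
    (hζ : ContDiffOn ℝ 1 ζ (closure Ω))
    (hφ : ContDiffOn ℝ 1 (fun p : Plane × ℝ => φ p.1 p.2) (closure Ω ×ˢ Icc 0 T))
    (hu : ContDiffOn ℝ 2 (fun p : Plane × ℝ => u p.1 p.2) (closure Ω ×ˢ Icc 0 T))
    {t : ℝ} (ht : t ∈ Icc 0 T) :
    energy Ω ρ g ζ φ u t = ∫ x in Ω, energyDensity ρ g ζ φ u (x, t) := by
  have h1 : IntegrableOn (fun x => ρ / 2 * φ x t * ‖u x t‖ ^ 2) Ω :=
    hΩ.integrableOn_of_continuousOn ((continuousOn_const.mul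
      (continuousOn_slice hφ.continuousOn ht)).mul
        ((continuousOn_slice hu.continuousOn ht).norm.pow 2))
  have h2 : IntegrableOn (fun x => ρ * g * |elevation ζ φ x t| ^ 2 / 2) Ω :=
    hΩ.integrableOn_of_continuousOn ((continuousOn_const.mul
      ((continuousOn_slice (contDiffOn_elevation hζ hφ).continuousOn ht).abs.pow 2)).div_const 2)
  rw [energy, kineticEnergy, potentialEnergy, ← integral_add h1 h2]
  refine integral_congr_ae (Eventually.of_forall fun x => ?_)
  simp only [energyDensity, sq_abs]
  ring

lemma deriv_energyDensity (hΩ : IsBoundedLipschitzDomain Ω) (hT : 0 < T)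
    (hζ : ContDiffOn ℝ 1 ζ (closure Ω))
    (hφ : ContDiffOn ℝ 1 (fun p : Plane × ℝ => φ p.1 p.2) (closure Ω ×ˢ Icc 0 T))
    (hu : ContDiffOn ℝ 2 (fun p : Plane × ℝ => u p.1 p.2) (closure Ω ×ˢ Icc 0 T))
    (hSWE : SatisfiesSWE Ω T ρ μ g ζ φ u) {x : Plane} (hx : x ∈ Ω) {t : ℝ} (ht : t ∈ Ioo 0 T) :
    deriv (fun s => energyDensity ρ g ζ φ u (x, s)) t
      = divergence Ω (energyFlux Ω ρ μ g (fun y => φ y t) (fun y => elevation ζ φ y t)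
          (fun y => u y t)) x
        + -(2 * μ) * (φ x t * frobeniusSq (strainRate Ω (fun y => u y t) x)) := by
  have hui : ∀ i, ContDiffOn ℝ 1 (fun p : Plane × ℝ => u p.1 p.2 i) (closure Ω ×ˢ Icc 0 T) :=
    contDiffOn_piLp 2 |>.1 (hu.of_le (by norm_num))
  have ht' := Ioo_subset_Icc_self ht
  have hxc := subset_closure hx
  have hη := contDiffOn_elevation hζ hφ
  have hφt : HasDerivAt (fun s => φ x s) (deriv (fun s => φ x s) t) t :=
    (hasDerivAt_time_slice hΩ.isOpen hφ hx ht).differentiableAt.hasDerivAt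
  have hut : ∀ i, HasDerivAt (fun s => u x s i) (deriv (fun s => u x s i) t) t := fun i =>
    (hasDerivAt_time_slice hΩ.isOpen (hui i) hx ht).differentiableAt.hasDerivAt
  have hd := fun {F : Plane × ℝ → ℝ} (hF : ContDiffOn ℝ 1 F (closure Ω ×ˢ Icc 0 T)) =>
    (contDiffOn_slice hF ht').differentiableOn one_ne_zero x hxc
  rw [← energy_balance_pointwise (hΩ.uniqueDiffOn_closure x hxc) (hd hφ) (hd hη)
    (fun i => hd (hui i)) (fun i j => hd (contDiffOn_strainRate hΩ hT hu i j))
    (hSWE.mass x hx t ht) (hSWE.momentum x hx t ht)]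
  refine HasDerivAt.deriv ?_
  have hnorm : HasDerivAt (fun s => ‖u x s‖ ^ 2) (2 * ∑ i, u x t i * deriv (fun s => u x s i) t)
      t := by
    simp only [norm_sq_plane]
    refine (((hut 0).mul (hut 0)).add ((hut 1).mul (hut 1))).congr_deriv ?_
    rw [Fin.sum_univ_two]; ring
  have hη' : HasDerivAt (fun s => elevation ζ φ x s) (deriv (fun s => φ x s) t) t :=
    hφt.sub_const (ζ x)
  refine (((hφt.mul hnorm).const_mul (ρ / 2)).add
    (((hη'.pow 2).div_const 2).const_mul (ρ * g))).congr_deriv ?_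
  simp only [Nat.cast_ofNat]
  ring

lemma continuousOn_I₄ (hΩ : IsBoundedLipschitzDomain Ω) (hT : 0 < T)
    (hφ : ContDiffOn ℝ 1 (fun p : Plane × ℝ => φ p.1 p.2) (closure Ω ×ˢ Icc 0 T))
    (hu : ContDiffOn ℝ 2 (fun p : Plane × ℝ => u p.1 p.2) (closure Ω ×ˢ Icc 0 T)) :
    ContinuousOn (I₄ Ω μ φ u) (Icc 0 T) :=
  continuousOn_const.mul (continuousOn_integral hΩ
    (hφ.continuousOn.mul (continuousOn_frobeniusSq_strainRate hΩ hT hu)))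

/-- The rate of change of the energy before the boundary conditions are used. -/
lemma hasDerivAt_energy (hΩ : IsBoundedLipschitzDomain Ω) (hT : 0 < T)
    (hζ : ContDiffOn ℝ 1 ζ (closure Ω))
    (hφ : ContDiffOn ℝ 1 (fun p : Plane × ℝ => φ p.1 p.2) (closure Ω ×ˢ Icc 0 T))
    (hu : ContDiffOn ℝ 2 (fun p : Plane × ℝ => u p.1 p.2) (closure Ω ×ˢ Icc 0 T))
    (hSWE : SatisfiesSWE Ω T ρ μ g ζ φ u) {t : ℝ} (ht : t ∈ Ioo 0 T) :
    HasDerivAt (energy Ω ρ g ζ φ u)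
      (∫ x in frontier Ω, inner ℝ (energyFlux Ω ρ μ g (fun y => φ y t)
          (fun y => elevation ζ φ y t) (fun y => u y t) x) (outwardNormal Ω x)
          ∂(Measure.hausdorffMeasure (1 : ℝ))
        + I₄ Ω μ φ u t) t := by
  have ht' := Ioo_subset_Icc_self ht
  have hW := contDiffOn_slice (contDiffOn_energyFlux hΩ hT (ρ := ρ) (μ := μ) (g := g) hφ
    (contDiffOn_elevation hζ hφ) hu) ht'
  have hE := hasDerivAt_integral hΩ hT (contDiffOn_energyDensity (ρ := ρ) (g := g) hζ hφ hu) ht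
  have heq : energy Ω ρ g ζ φ u =ᶠ[𝓝 t] fun t => ∫ x in Ω, energyDensity ρ g ζ φ u (x, t) := by
    filter_upwards [Icc_mem_nhds ht.1 ht.2] with s hs using energy_eq_integral hΩ hζ hφ hu hs
  refine (hE.congr_of_eventuallyEq heq).congr_deriv ?_
  rw [setIntegral_congr_fun hΩ.isOpen.measurableSet fun x hx =>
      deriv_energyDensity hΩ hT hζ hφ hu hSWE hx ht,
    integral_add (hΩ.integrableOn_divergence hW), hΩ.integral_divergence hW, I₄,
    integral_const_mul]
  exact (hΩ.integrableOn_of_continuousOn (continuousOn_slice (hφ.continuousOn.mul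
    (continuousOn_frobeniusSq_strainRate hΩ hT hu)) ht')).const_mul _

/-- The energy flux through the Dirichlet and the slip boundary vanishes. -/
lemma integral_frontier_energyFlux (hΩ : IsBoundedLipschitzDomain Ω)
    (hΓ : IsBoundaryPartition Ω ΓD ΓS ΓT) (hD : DirichletCondition T ΓD u)
    (hS : SlipCondition Ω T ΓS u) (p q : Plane → ℝ) {t : ℝ} (ht : t ∈ Ioo 0 T) :
    ∫ x in frontier Ω, inner ℝ (energyFlux Ω ρ μ g p q (fun y => u y t) x) (outwardNormal Ω x)
        ∂(Measure.hausdorffMeasure (1 : ℝ))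
      = ∫ x in ΓT, inner ℝ (energyFlux Ω ρ μ g p q (fun y => u y t) x) (outwardNormal Ω x)
        ∂(Measure.hausdorffMeasure (1 : ℝ)) := by
  refine setIntegral_eq_of_subset_of_ae_sdiff_eq_zero
    isClosed_frontier.measurableSet.nullMeasurableSet hΓ.subset_T ?_
  have hn := hΩ.ae_exists_isUnitOutwardNormal
  rw [ae_restrict_iff' isClosed_frontier.measurableSet] at hn
  have hcover : ∀ᵐ x ∂(Measure.hausdorffMeasure (1 : ℝ)),
      x ∉ frontier Ω \ (ΓD ∪ ΓS ∪ ΓT) := measure_eq_zero_iff_ae_notMem.1 hΓ.cover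
  filter_upwards [hn, hcover] with x hx hxc hxT
  have hnx := hx hxT.1
  rw [inner_energyFlux]
  by_cases hxD : x ∈ ΓD
  · simp [hD x hxD t ht]
  · have hxS : x ∈ ΓS := by
      by_contra hxS
      exact hxc ⟨hxT.1, by rintro ((h | h) | h) <;> [exact hxD h; exact hxS h; exact hxT.2 h]⟩
    obtain ⟨h1, h2⟩ := hS x hxS _ hnx t ht
    -- On the slip boundary the viscous term vanishes by orthogonality of `D(u) n` and `u`, the
    -- other two because `u·n = 0`.
    rw [inner_eq_zero_of_cross_eq_zero hnx.1 h1 h2, h2]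
    ring

/-- Splitting the integral needs each term integrable. Each is a continuous field paired with the
bounded measurable normal, the viscous one after `D(u) n · u` is rewritten as `D(u) u · n`. -/
lemma integral_energyFlux_eq (hΩ : IsBoundedLipschitzDomain Ω) (hT : 0 < T)
    {G : Set Plane} (hG : G ⊆ frontier Ω)
    (hζ : ContDiffOn ℝ 1 ζ (closure Ω))
    (hφ : ContDiffOn ℝ 1 (fun p : Plane × ℝ => φ p.1 p.2) (closure Ω ×ˢ Icc 0 T))
    (hu : ContDiffOn ℝ 2 (fun p : Plane × ℝ => u p.1 p.2) (closure Ω ×ˢ Icc 0 T))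
    {t : ℝ} (ht : t ∈ Icc 0 T) :
    ∫ x in G, inner ℝ (energyFlux Ω ρ μ g (fun y => φ y t) (fun y => elevation ζ φ y t)
        (fun y => u y t) x) (outwardNormal Ω x) ∂(Measure.hausdorffMeasure (1 : ℝ))
      = I₁ Ω ρ φ u G t + I₂ Ω ρ g ζ φ u G t + I₃ Ω μ φ u G t := by
  have hui : ∀ i, ContDiffOn ℝ 1 (fun p : Plane × ℝ => u p.1 p.2 i) (closure Ω ×ˢ Icc 0 T) :=
    contDiffOn_piLp 2 |>.1 (hu.of_le (by norm_num))
  have hint : ∀ {V : Plane → Plane}, ContinuousOn V (closure Ω) →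
      Integrable (fun x => inner ℝ (V x) (outwardNormal Ω x)) (arcLength G) := fun {V} hV => by
    have h1 : IntegrableOn (fun x => inner ℝ (V x) (outwardNormal Ω x)) (frontier Ω)
        (Measure.hausdorffMeasure (1 : ℝ)) := by
      have hVi : ∀ i, ContinuousOn (fun x => V x i) (closure Ω) := fun i => by fun_prop
      refine (integrable_finsetSum Finset.univ fun i _ =>
        hΩ.integrable_boundary (hVi i) (EuclideanSpace.single i 1)).congr
          (Eventually.of_forall fun x => ?_)
      simp [PiLp.inner_apply, Fin.sum_univ_two, mul_comm]
    exact h1.mono_set hG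
  have hφc := continuousOn_slice hφ.continuousOn ht
  have huc := continuousOn_slice hu.continuousOn ht
  have hηc := continuousOn_slice (contDiffOn_elevation hζ hφ).continuousOn ht
  have hDu : ContinuousOn (fun x => applyMatrix (strainRate Ω (fun y => u y t) x) (u x t))
      (closure Ω) := by
    refine (PiLp.continuous_toLp 2 _).comp_continuousOn (continuousOn_pi.2 fun i => ?_)
    simp only [Matrix.mulVec, dotProduct]
    exact continuousOn_finsetSum _ fun j _ =>
      (continuousOn_slice (contDiffOn_strainRate hΩ hT hu i j).continuousOn ht).mul
        (continuousOn_slice (hui j).continuousOn ht)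
  have h1 : Integrable (fun x => φ x t * ‖u x t‖ ^ 2 * inner ℝ (u x t) (outwardNormal Ω x))
      (arcLength G) := by
    refine (hint ((hφc.mul (huc.norm.pow 2)).smul huc)).congr (Eventually.of_forall fun x => ?_)
    exact real_inner_smul_left _ _ _
  have h2 : Integrable (fun x => φ x t * elevation ζ φ x t * inner ℝ (u x t) (outwardNormal Ω x))
      (arcLength G) := by
    refine (hint ((hφc.mul hηc).smul huc)).congr (Eventually.of_forall fun x => ?_)
    exact real_inner_smul_left _ _ _
  have h3 : Integrable (fun x => φ x t * inner ℝ (applyMatrix (strainRate Ω (fun y => u y t) x)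
      (outwardNormal Ω x)) (u x t)) (arcLength G) := by
    refine (hint (hφc.smul hDu)).congr (Eventually.of_forall fun x => ?_)
    simp only [inner_applyMatrix_strainRate Ω _ x (outwardNormal Ω x)]
    exact real_inner_smul_left _ _ _
  simp only [inner_energyFlux]
  rw [← arcLength, integral_sub (h3.const_mul _) ((h1.const_mul _).fun_add (h2.const_mul _)),
    integral_add (h1.const_mul _) (h2.const_mul _), integral_const_mul, integral_const_mul,
    integral_const_mul, I₁, I₂, I₃]
  ring

/-- The equations and boundary conditions hold for `0 < t < T` only; continuity of the energy and of
the right-hand side on `[0, T]` carries the balance to the end points. -/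
lemma hasDerivWithinAt_energy (hΩ : IsBoundedLipschitzDomain Ω) (hT : 0 < T)
    (hΓ : IsBoundaryPartition Ω ΓD ΓS ΓT)
    (hζ : ContDiffOn ℝ 1 ζ (closure Ω))
    (hφ : ContDiffOn ℝ 1 (fun p : Plane × ℝ => φ p.1 p.2) (closure Ω ×ˢ Icc 0 T))
    (hu : ContDiffOn ℝ 2 (fun p : Plane × ℝ => u p.1 p.2) (closure Ω ×ˢ Icc 0 T))
    (hSWE : SatisfiesSWE Ω T ρ μ g ζ φ u) (hD : DirichletCondition T ΓD u)
    (hS : SlipCondition Ω T ΓS u) {t : ℝ} (ht : t ∈ Icc 0 T) :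
    HasDerivWithinAt (energy Ω ρ g ζ φ u)
      (I₁ Ω ρ φ u ΓT t + I₂ Ω ρ g ζ φ u ΓT t + I₃ Ω μ φ u ΓT t + I₄ Ω μ φ u t) (Icc 0 T) t := by
  have hE : ContinuousOn (energy Ω ρ g ζ φ u) (Icc 0 T) :=
    (continuousOn_integral hΩ (contDiffOn_energyDensity hζ hφ hu).continuousOn).congr
      fun s hs => energy_eq_integral hΩ hζ hφ hu hs
  have hflux := contDiffOn_energyFlux hΩ hT (ρ := ρ) (μ := μ) (g := g) hφ
    (contDiffOn_elevation hζ hφ) hu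
  have hR : ContinuousOn (fun t => I₁ Ω ρ φ u ΓT t + I₂ Ω ρ g ζ φ u ΓT t + I₃ Ω μ φ u ΓT t
      + I₄ Ω μ φ u t) (Icc 0 T) := by
    refine ContinuousOn.add ?_ (continuousOn_I₄ hΩ hT hφ hu)
    refine (continuousOn_integral_inner hΩ hflux.continuousOn hΓ.measurable_T
      (hΓ.subset_T.trans frontier_subset_closure)
      ((measure_mono hΓ.subset_T).trans_lt hΩ.hausdorffMeasure_frontier_lt_top)
      (hΩ.aestronglyMeasurable_outwardNormal.mono_measure (Measure.restrict_mono_set _ hΓ.subset_T))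
      (norm_outwardNormal_le Ω)).congr fun s hs => ?_
    exact (integral_energyFlux_eq hΩ hT hΓ.subset_T hζ hφ hu hs).symm
  refine hasDerivWithinAt_Icc_of_continuousOn hT hE hR (fun s hs => ?_) ht
  refine (hasDerivAt_energy hΩ hT hζ hφ hu hSWE hs).congr_deriv ?_
  rw [integral_frontier_energyFlux hΩ hΓ hD hS _ _ hs,
    integral_energyFlux_eq hΩ hT hΓ.subset_T hζ hφ hu (Ioo_subset_Icc_self hs)]

lemma I₄_nonpos (hΩ : IsBoundedLipschitzDomain Ω) (hμ : 0 < μ) {t : ℝ}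
    (hpos : ∀ x ∈ closure Ω, 0 < φ x t) : I₄ Ω μ φ u t ≤ 0 := by
  refine mul_nonpos_of_nonpos_of_nonneg (by linarith) ?_
  refine setIntegral_nonneg hΩ.isOpen.measurableSet fun x hx =>
    mul_nonneg (hpos x (subset_closure hx)).le ?_
  exact Finset.sum_nonneg fun i _ => Finset.sum_nonneg fun j _ => sq_nonneg _

end

end ShallowWater

/-! ### The energy theorem -/

theorem corollary1
    (Ω ΓD ΓS ΓT : Set ShallowWater.Plane)
    (hΩ : ShallowWater.IsBoundedLipschitzDomain Ω)
    (hΓ : ShallowWater.IsBoundaryPartition Ω ΓD ΓS ΓT)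
    (T ρ μ g c₀ : ℝ) (hT : 0 < T) (hρ : 0 < ρ) (hμ : 0 < μ) (hg : 0 < g) (hc₀ : 0 < c₀)
    (ζ : ShallowWater.Plane → ℝ)
    (hζ : ContDiffOn ℝ 1 ζ (closure Ω)) (hζ_pos : ∀ x ∈ closure Ω, 0 < ζ x)
    (φ : ShallowWater.Plane → ℝ → ℝ) (u : ShallowWater.Plane → ℝ → ShallowWater.Plane)
    (hφ : ContDiffOn ℝ 1 (fun p : ShallowWater.Plane × ℝ => φ p.1 p.2) (closure Ω ×ˢ Icc 0 T))
    (hu : ContDiffOn ℝ 2 (fun p : ShallowWater.Plane × ℝ => u p.1 p.2) (closure Ω ×ˢ Icc 0 T))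
    (hSWE : ShallowWater.SatisfiesSWE Ω T ρ μ g ζ φ u)
    (hD : ShallowWater.DirichletCondition T ΓD u)
    (hS : ShallowWater.SlipCondition Ω T ΓS u)
    (hTr : ShallowWater.TransmissionCondition Ω T g c₀ ζ ΓT φ u) :
    (∀ t ∈ Icc 0 T,
      HasDerivWithinAt (ShallowWater.energy Ω ρ g ζ φ u)
        (ShallowWater.I₁ Ω ρ φ u ΓT t + ShallowWater.I₂ Ω ρ g ζ φ u ΓT t
          + ShallowWater.I₃ Ω μ φ u ΓT t + ShallowWater.I₄ Ω μ φ u t) (Icc 0 T) t) ∧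
    (ΓT = ∅ → (∀ x ∈ closure Ω, ∀ t ∈ Icc 0 T, 0 < φ x t) →
      (∀ t ∈ Icc 0 T,
        HasDerivWithinAt (ShallowWater.energy Ω ρ g ζ φ u)
          (ShallowWater.I₄ Ω μ φ u t) (Icc 0 T) t ∧
        ShallowWater.I₄ Ω μ φ u t ≤ 0) ∧
      AntitoneOn (ShallowWater.energy Ω ρ g ζ φ u) (Icc 0 T)) := by
  have main : ∀ t ∈ Icc 0 T, _ := fun t ht =>
    ShallowWater.hasDerivWithinAt_energy hΩ hT hΓ hζ hφ hu hSWE hD hS ht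
  refine ⟨main, fun hΓT hpos => ?_⟩
  have hder : ∀ t ∈ Icc 0 T, HasDerivWithinAt (ShallowWater.energy Ω ρ g ζ φ u)
      (ShallowWater.I₄ Ω μ φ u t) (Icc 0 T) t := fun t ht => by
    have h := main t ht
    simpa [hΓT, ShallowWater.I₁, ShallowWater.I₂, ShallowWater.I₃, ShallowWater.arcLength] using h
  have hle : ∀ t ∈ Icc 0 T, ShallowWater.I₄ Ω μ φ u t ≤ 0 := fun t ht =>
    ShallowWater.I₄_nonpos hΩ hμ fun x hx => hpos x hx t ht
  refine ⟨fun t ht => ⟨hder t ht, hle t ht⟩, ?_⟩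
  refine antitoneOn_of_deriv_nonpos (convex_Icc 0 T) (fun t ht => (hder t ht).continuousWithinAt)
    (fun t ht => (hder t (interior_subset ht)).differentiableWithinAt.mono interior_subset)
    fun t ht => ?_
  rw [((hder t (interior_subset ht)).hasDerivAt (mem_interior_iff_mem_nhds.1 ht)).deriv]
  exact hle t (interior_subset ht)
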